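/- Let $R=[x_l,x_r]\times[y_l,y_r]\times[z_l,z_r]$ be a nondegenerate box, let $K\le 0$ and $\sigma\ge 0$ be constants, and consider the problem $$u_{xx}+u_{yy}+u_{zz}+Ku=f\ \text{ in the interior of }R,\qquad \frac{\partial u}{\partial n}+\sigma u=-u_x+\sigma u=g(y,z)\ \text{ on } x=x_l,\qquad u=u_1\ \text{ on the other five (closed) faces},$$ with $f$ continuous on $R$. Take a uniform mesh with the same mesh size $h>0$ in all directions, $x_i=x_l+ih$ $(0\le i\le N_x,\ x_{N_x}=x_r)$, and similarly $y_j$ $(0\le j\le N_y)$ and $z_k$ $(0\le k\le N_z)$. Write $f_{ijk}=f(x_i,y_j,z_k)$, $g_{jk}=g(y_j,z_k)$. Besides its values on the grid, the scheme uses extension values $\tilde f_{jk}$ of $f$ at $(x_l-h,y_j,z_k)$, $0<j<N_y$, $0<k<N_z$; the extension is called third-order accurate with constant $c\ge 0$ if $$\Bigl|\tilde f_{jk}-\bigl(f-hf_x+\tfrac{h^2}{2}f_{xx}\bigr)(x_l,y_j,z_k)\Bigr|\le c\,h^3 ,$$ with one-sided $x$-derivatives, and exact if $c=0$. The term $Ku$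 is treated as a source: put $F_{ijk}=f_{ijk}-KU_{ijk}$ for $i\ge 0$ and $F_{-1,j,k}=\tilde f_{jk}-K\,[\,U_{1jk}+2h(g_{jk}-\sigma U_{0jk})\,]$, the bracket being the ghost value of $U$ at $x_l-h$ given by the centred Robin condition. The finite difference solution $U$ is determined by the following equations. (i) At grid points with $0<i<N_x$, $0<j<N_y$, $0<k<N_z$: $$-\frac{4}{h^2}U_{ijk}+\frac1{3h^2}\sum_{\text{6 face neighbours}}U+\frac1{6h^2}\sum_{\text{12 edge neighbours}}U=\frac1{12}\Bigl(6F_{ijk}+\sum_{\text{6 face neighbours}}F\Bigr).$$ (ii) At $(x_0,y_j,z_k)$ with $0<j<N_y$, $0<k<N_z$: $$\frac1{6h^2}\Bigl[-12(2+\sigma h)U_{0jk}+2\!\!\sum_{|a|+|b|=1}\!\!U_{0,j+a,k+b}+\!\!\sum_{|a|=|b|=1}\!\!U_{0,j+a,k+b}+4U_{1jk}+2\!\!\sum_{|a|+|b|=1}\!\!U_{1,j+a,k+b}\Bigr]$$ $$=\frac1{12}\Bigl[6F_{0jk}+\!\!\sum_{|a|+|b|=1}\!\!F_{0,j+a,k+b}-F_{-1,j,k}+3F_{1jk}\Bigr]-\frac2h\,g_{jk}.$$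 (iii) At the grid points on the other five faces: $U_{ijk}=u_1(x_i,y_j,z_k)$. Then: 1. For every such mesh and all data $f,\tilde f,g,u_1$, the scheme has exactly one solution $U$ on the grid. 2. If $K=\sigma=0$, the solution $u$ is a polynomial of total degree at most $4$ on $R$, and the extension is exact, then $U_{ijk}=u(x_i,y_j,z_k)$ at all grid points. 3. There is a constant $C$ depending only on the box, $K$ and $\sigma$ such that, whenever $u\in C^6(R)$ solves the problem and all its derivatives (as multilinear maps) of order at most $6$ are bounded in norm by $M$ on $R$, and the extension is third-order accurate with constant $c$, for every such mesh $$\max_{i,j,k}|u(x_i,y_j,z_k)-U_{ijk}|\le C\,(M+c)\,h^4 .$$ -/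

import Mathlib

open Set

namespace RobinHOC

/-- A nondegenerate rectangular box `[xl, xr] × [yl, yr] × [zl, zr]`. -/
structure Box where
  xl : ℝ
  xr : ℝ
  yl : ℝ
  yr : ℝ
  zl : ℝ
  zr : ℝ
  hx : xl < xr
  hy : yl < yr
  hz : zl < zr

/-- The closed box as a subset of `ℝ × ℝ × ℝ`. -/
def Box.closed (B : Box) : Set (ℝ × ℝ × ℝ) :=
  Icc B.xl B.xr ×ˢ Icc B.yl B.yr ×ˢ Icc B.zl B.zr

/-- The Laplacian `u_xx + u_yy + u_zz` (used only at points of the open box). -/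
noncomputable def laplacian (u : ℝ × ℝ × ℝ → ℝ) (x y z : ℝ) : ℝ :=
  iteratedDeriv 2 (fun s => u (s, y, z)) x + iteratedDeriv 2 (fun s => u (x, s, z)) y +
    iteratedDeriv 2 (fun s => u (x, y, s)) z

/-- `u` solves `Δu + K u = f` in the open box, with the Robin condition
`∂u/∂n + σ u = g` on the face `x = xl` (where `∂/∂n = -∂/∂x`, a one-sided derivative)
and the Dirichlet condition `u = u₁` on the five other closed faces.
The source `f` is continuous up to the boundary. -/
structure IsSolution (B : Box) (K σ : ℝ) (u f u₁ : ℝ × ℝ × ℝ → ℝ) (g : ℝ → ℝ → ℝ) : Prop where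
  source_cont : ContinuousOn f B.closed
  pde : ∀ x ∈ Ioo B.xl B.xr, ∀ y ∈ Ioo B.yl B.yr, ∀ z ∈ Ioo B.zl B.zr,
    laplacian u x y z + K * u (x, y, z) = f (x, y, z)
  dirichlet : ∀ x y z : ℝ, (x, y, z) ∈ B.closed →
    (x = B.xr ∨ y = B.yl ∨ y = B.yr ∨ z = B.zl ∨ z = B.zr) → u (x, y, z) = u₁ (x, y, z)
  robin : ∀ y ∈ Ioo B.yl B.yr, ∀ z ∈ Ioo B.zl B.zr,
    -derivWithin (fun s => u (s, y, z)) (Icc B.xl B.xr) B.xl + σ * u (B.xl, y, z) = g y z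

/-- A uniform mesh of the box: one mesh size `h` in all three directions. -/
structure Mesh (B : Box) where
  h : ℝ
  Nx : ℕ
  Ny : ℕ
  Nz : ℕ
  h_pos : 0 < h
  hNx : B.xl + Nx * h = B.xr
  hNy : B.yl + Ny * h = B.yr
  hNz : B.zl + Nz * h = B.zr

namespace Mesh

variable {B : Box}

/-- The grid coordinates `x_i`, `y_j`, `z_k`. -/
noncomputable def x (m : Mesh B) (i : ℤ) : ℝ := B.xl + i * m.h

noncomputable def y (m : Mesh B) (j : ℤ) : ℝ := B.yl + j * m.h

noncomputable def z (m : Mesh B) (k : ℤ) : ℝ := B.zl + k * m.h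

/-- The indices of the grid points (in the closed box). -/
def IsGridIndex (m : Mesh B) (i j k : ℤ) : Prop :=
  (0 ≤ i ∧ i ≤ m.Nx) ∧ (0 ≤ j ∧ j ≤ m.Ny) ∧ (0 ≤ k ∧ k ≤ m.Nz)

/-- The values of a function at the grid points. -/
noncomputable def sample (m : Mesh B) (v : ℝ × ℝ × ℝ → ℝ) (i j k : ℤ) : ℝ :=
  v (m.x i, m.y j, m.z k)

end Mesh

/-- The 19-point discrete Laplacian at an interior grid point. -/
noncomputable def lap19 (h : ℝ) (U : ℤ → ℤ → ℤ → ℝ) (i j k : ℤ) : ℝ :=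
  -(4 / h ^ 2) * U i j k
  + 1 / (3 * h ^ 2) *
    (U (i + 1) j k + U (i - 1) j k + U i (j + 1) k + U i (j - 1) k
      + U i j (k + 1) + U i j (k - 1))
  + 1 / (6 * h ^ 2) *
    (U (i + 1) (j + 1) k + U (i + 1) (j - 1) k + U (i - 1) (j + 1) k + U (i - 1) (j - 1) k
      + U (i + 1) j (k + 1) + U (i + 1) j (k - 1) + U (i - 1) j (k + 1) + U (i - 1) j (k - 1)
      + U i (j + 1) (k + 1) + U i (j - 1) (k + 1) + U i (j + 1) (k - 1) + U i (j - 1) (k - 1))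

/-- The 7-point average of the source at an interior grid point. -/
noncomputable def avg7 (F : ℤ → ℤ → ℤ → ℝ) (i j k : ℤ) : ℝ :=
  1 / 12 *
    (6 * F i j k + F (i + 1) j k + F (i - 1) j k + F i (j + 1) k + F i (j - 1) k
      + F i j (k + 1) + F i j (k - 1))

/-- The boundary stencil for `U` at the grid point `(x_0, y_j, z_k)`: the first three lines hold
the coefficients on the layer `x_0`, the last two those on the layer `x_1`. -/
noncomputable def robinLap (h σ : ℝ) (U : ℤ → ℤ → ℤ → ℝ) (j k : ℤ) : ℝ :=
  1 / (6 * h ^ 2) *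
    (-(12 * (2 + σ * h)) * U 0 j k
      + 2 * (U 0 (j + 1) k + U 0 (j - 1) k + U 0 j (k + 1) + U 0 j (k - 1))
      + (U 0 (j + 1) (k + 1) + U 0 (j + 1) (k - 1) + U 0 (j - 1) (k + 1) + U 0 (j - 1) (k - 1)))
  + 1 / (6 * h ^ 2) *
    (4 * U 1 j k
      + 2 * (U 1 (j + 1) k + U 1 (j - 1) k + U 1 j (k + 1) + U 1 j (k - 1)))

/-- The boundary stencil for the source at `(x_0, y_j, z_k)`; it uses one value on the layer
`x_{-1} = xl - h` outside the box. -/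
noncomputable def robinAvg (F : ℤ → ℤ → ℤ → ℝ) (j k : ℤ) : ℝ :=
  1 / 12 *
    (6 * F 0 j k + F 0 (j + 1) k + F 0 (j - 1) k + F 0 j (k + 1) + F 0 j (k - 1)
      - F (-1) j k + 3 * F 1 j k)

/-- The value of `U` at the ghost point `(x_{-1}, y_j, z_k)`, eliminated by the centred Robin
condition `-(U_1 - U_{-1}) / (2h) + σ U_0 = g`. -/
def ghost (h σ gjk : ℝ) (U : ℤ → ℤ → ℤ → ℝ) (j k : ℤ) : ℝ :=
  U 1 j k + 2 * h * (gjk - σ * U 0 j k)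

/-- The term `K u` is treated as part of the source: this is the grid function `f - K U`.
On the outer layer `i = -1` the value of `f` is the extension value `fext j k`, and that of `U`
is the ghost value. -/
noncomputable def source {B : Box} (m : Mesh B) (K σ : ℝ) (f : ℝ × ℝ × ℝ → ℝ) (fext : ℤ → ℤ → ℝ)
    (g : ℝ → ℝ → ℝ) (U : ℤ → ℤ → ℤ → ℝ) (i j k : ℤ) : ℝ :=
  if i = -1 then fext j k - K * ghost m.h σ (g (m.y j) (m.z k)) U j k
  else m.sample f i j k - K * U i j k

/-- `U` is a finite difference solution for the data `f`, `fext`, `u₁`, `g`. Only the values of `U`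
at grid indices matter. -/
structure IsFDSolution {B : Box} (m : Mesh B) (K σ : ℝ) (f : ℝ × ℝ × ℝ → ℝ) (fext : ℤ → ℤ → ℝ)
    (u₁ : ℝ × ℝ × ℝ → ℝ) (g : ℝ → ℝ → ℝ) (U : ℤ → ℤ → ℤ → ℝ) : Prop where
  interior : ∀ i j k : ℤ, 0 < i → i < m.Nx → 0 < j → j < m.Ny → 0 < k → k < m.Nz →
    lap19 m.h U i j k = avg7 (source m K σ f fext g U) i j k
  robin : ∀ j k : ℤ, 0 < j → j < m.Ny → 0 < k → k < m.Nz →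
    robinLap m.h σ U j k =
      robinAvg (source m K σ f fext g U) j k + -2 / m.h * g (m.y j) (m.z k)
  dirichlet : ∀ i j k : ℤ, m.IsGridIndex i j k →
    (i = m.Nx ∨ j = 0 ∨ j = m.Ny ∨ k = 0 ∨ k = m.Nz) → U i j k = m.sample u₁ i j k

/-- The values `fext j k` extend `f` to the grid points `(x_{-1}, y_j, z_k)` with third order
accuracy, with constant `c`: they agree up to `c h³` with the quadratic Taylor polynomial of `f`
in `x`, taken from inside the box at `(x_0, y_j, z_k)` and evaluated at `x_0 - h`. -/
def IsExtension {B : Box} (m : Mesh B) (f : ℝ × ℝ × ℝ → ℝ) (c : ℝ) (fext : ℤ → ℤ → ℝ) : Prop :=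
  ∀ j k : ℤ, 0 < j → j < m.Ny → 0 < k → k < m.Nz →
    |fext j k -
      (f (B.xl, m.y j, m.z k)
        - m.h * derivWithin (fun s => f (s, m.y j, m.z k)) (Icc B.xl B.xr) B.xl
        + m.h ^ 2 / 2 *
          iteratedDerivWithin 2 (fun s => f (s, m.y j, m.z k)) (Icc B.xl B.xr) B.xl)|
      ≤ c * m.h ^ 3

/-- On the closed box `u` is a polynomial in `x, y, z` of total degree at most four. -/
def IsQuarticPolynomial (B : Box) (u : ℝ × ℝ × ℝ → ℝ) : Prop :=
  ∃ p : MvPolynomial (Fin 3) ℝ, p.totalDegree ≤ 4 ∧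
    ∀ x y z : ℝ, (x, y, z) ∈ B.closed → u (x, y, z) = MvPolynomial.eval ![x, y, z] p

end RobinHOC

/-! The proof is stability plus consistency. Once `K U` is moved to the left and the ghost value
eliminated, the scheme is a linear system given by `opInt`, `opRobin` and the Dirichlet values
(`isFDSolution_iff`).

Stability (`Mesh.stability`): a grid function with zero Dirichlet values and residual at most `s`
inside and `s / h` on the Robin face is bounded by `s (L + L²/2)`, with `L = xr - xl`, on every
mesh. If `-K h² ≤ 4`, all off-diagonal coefficients are nonnegative and the row sums nonpositive, so
a discrete maximum principle allows comparison with a quadratic barrier in `x`. If `-K h² ≥ 4`, the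
face-neighbour coefficients are nonpositive, but the matrix is diagonally dominant with margin `4 /
h²`, and `h ≤ L` finishes. Since the Robin rows tolerate `s / h`, an `O(h³)` truncation error there
costs no order of convergence. The case `s = 0` gives uniqueness and, in finite dimension,
existence.

Consistency: Taylor expansion bounds the truncation error by `9 M₆ h⁴` inside
(`Jet.abs_lap19_sub_le`) and by `(11 M₅ + δ) h³` on the Robin face (`Jet.abs_robinLap_sub_le`),
where `Mₙ` bounds the partial derivatives of order `n` and `δ` measures the error of the source
value outside the box. `Jet.error_le` combines this with stability; `M₃` enters only as `|K| M₃`,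
through the ghost value. For quartics with `K = 0` and exact extension every term vanishes; for
`C^6` solutions all are controlled by `M + c`. A `Jet` packages the partial derivatives, so both
cases share one error bound. -/

namespace RobinHOC

/-! ### Discrete maximum principle and diagonal dominance -/

/-- The interior operator of the scheme, with the term `K U` moved to the left-hand side. -/
noncomputable def opInt (h K : ℝ) (v : ℤ → ℤ → ℤ → ℝ) (i j k : ℤ) : ℝ :=
  lap19 h v i j k + K * avg7 v i j k

/-- The boundary operator of the scheme, with the terms in `K U` moved to the left-hand side. -/
noncomputable def opRobin (h K σ : ℝ) (v : ℤ → ℤ → ℤ → ℝ) (j k : ℤ) : ℝ :=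
  robinLap h σ v j k + K / 12 * ((6 + 2 * h * σ) * v 0 j k
    + (v 0 (j + 1) k + v 0 (j - 1) k + v 0 j (k + 1) + v 0 j (k - 1)) + 2 * v 1 j k)

/-- `v` is below `P` on the `3 × 3 × 3` block around `(i, j, k)`, as far as the layers `≥ 0`. -/
def BlockLE (v : ℤ → ℤ → ℤ → ℝ) (P : ℝ) (i j k : ℤ) : Prop :=
  ∀ a b c : ℤ, 0 ≤ a → i - 1 ≤ a → a ≤ i + 1 → j - 1 ≤ b → b ≤ j + 1 → k - 1 ≤ c → c ≤ k + 1 →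
    v a b c ≤ P

/-- On fine meshes the face coefficient `1/(3h²) + K/12` and the edge coefficient are nonnegative,
so replacing every neighbour by `P` can only increase the value. What is left is the row sum `K`
times `P`. -/
theorem opInt_le_of_blockLE {h K P : ℝ} (hh : 0 < h) (hK : K ≤ 0) (hs : -K * h ^ 2 ≤ 4)
    {v : ℤ → ℤ → ℤ → ℝ} {i j k : ℤ} (hi : 0 < i) (hP : 0 ≤ P) (hv : v i j k = P)
    (H : BlockLE v P i j k) : opInt h K v i j k ≤ 0 := by
  have hb : 0 ≤ 1 / (6 * h ^ 2) := by positivity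
  have ha : 0 ≤ 1 / (3 * h ^ 2) + K / 12 := by
    have : 1 / (3 * h ^ 2) + K / 12 = (4 + K * h ^ 2) / (12 * h ^ 2) := by field_simp; ring
    rw [this]; apply div_nonneg <;> nlinarith
  have e : opInt h K v i j k = -(4 / h ^ 2) * P + K / 2 * P
      + (1 / (3 * h ^ 2) + K / 12) * (v (i + 1) j k + v (i - 1) j k + v i (j + 1) k
        + v i (j - 1) k + v i j (k + 1) + v i j (k - 1))
      + 1 / (6 * h ^ 2) * (v (i + 1) (j + 1) k + v (i + 1) (j - 1) k + v (i - 1) (j + 1) k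
        + v (i - 1) (j - 1) k + v (i + 1) j (k + 1) + v (i + 1) j (k - 1) + v (i - 1) j (k + 1)
        + v (i - 1) j (k - 1) + v i (j + 1) (k + 1) + v i (j - 1) (k + 1) + v i (j + 1) (k - 1)
        + v i (j - 1) (k - 1)) := by
    rw [← hv, opInt, lap19, avg7]; ring
  have h1 : v (i + 1) j k + v (i - 1) j k + v i (j + 1) k
        + v i (j - 1) k + v i j (k + 1) + v i j (k - 1) ≤ 6 * P := by
    have := H (i + 1) j k (by lia) (by lia) (by lia) (by lia) (by lia) (by lia) (by lia)
    have := H (i - 1) j k (by lia) (by lia) (by lia) (by lia) (by lia) (by lia) (by lia)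
    have := H i (j + 1) k (by lia) (by lia) (by lia) (by lia) (by lia) (by lia) (by lia)
    have := H i (j - 1) k (by lia) (by lia) (by lia) (by lia) (by lia) (by lia) (by lia)
    have := H i j (k + 1) (by lia) (by lia) (by lia) (by lia) (by lia) (by lia) (by lia)
    have := H i j (k - 1) (by lia) (by lia) (by lia) (by lia) (by lia) (by lia) (by lia)
    linarith
  have h2 : v (i + 1) (j + 1) k + v (i + 1) (j - 1) k + v (i - 1) (j + 1) k
        + v (i - 1) (j - 1) k + v (i + 1) j (k + 1) + v (i + 1) j (k - 1) + v (i - 1) j (k + 1)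
        + v (i - 1) j (k - 1) + v i (j + 1) (k + 1) + v i (j - 1) (k + 1) + v i (j + 1) (k - 1)
        + v i (j - 1) (k - 1) ≤ 12 * P := by
    have := H (i + 1) (j + 1) k (by lia) (by lia) (by lia) (by lia) (by lia) (by lia) (by lia)
    have := H (i + 1) (j - 1) k (by lia) (by lia) (by lia) (by lia) (by lia) (by lia) (by lia)
    have := H (i - 1) (j + 1) k (by lia) (by lia) (by lia) (by lia) (by lia) (by lia) (by lia)
    have := H (i - 1) (j - 1) k (by lia) (by lia) (by lia) (by lia) (by lia) (by lia) (by lia)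
    have := H (i + 1) j (k + 1) (by lia) (by lia) (by lia) (by lia) (by lia) (by lia) (by lia)
    have := H (i + 1) j (k - 1) (by lia) (by lia) (by lia) (by lia) (by lia) (by lia) (by lia)
    have := H (i - 1) j (k + 1) (by lia) (by lia) (by lia) (by lia) (by lia) (by lia) (by lia)
    have := H (i - 1) j (k - 1) (by lia) (by lia) (by lia) (by lia) (by lia) (by lia) (by lia)
    have := H i (j + 1) (k + 1) (by lia) (by lia) (by lia) (by lia) (by lia) (by lia) (by lia)
    have := H i (j - 1) (k + 1) (by lia) (by lia) (by lia) (by lia) (by lia) (by lia) (by lia)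
    have := H i (j + 1) (k - 1) (by lia) (by lia) (by lia) (by lia) (by lia) (by lia) (by lia)
    have := H i (j - 1) (k - 1) (by lia) (by lia) (by lia) (by lia) (by lia) (by lia) (by lia)
    linarith
  have h3 := mul_le_mul_of_nonneg_left h1 ha
  have h4 := mul_le_mul_of_nonneg_left h2 hb
  have h5 : -(4 / h ^ 2) * P + K / 2 * P + (1 / (3 * h ^ 2) + K / 12) * (6 * P)
      + 1 / (6 * h ^ 2) * (12 * P) = K * P := by field_simp; ring
  have h6 : K * P ≤ 0 := mul_nonpos_of_nonpos_of_nonneg hK hP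
  linarith

/-- The same sign argument. Eliminating the ghost layer doubles the weights towards layer `1`; the
row sum is `K (1 + hσ/6) - 2σ/h`, still nonpositive. -/
theorem opRobin_le_of_blockLE {h K σ P : ℝ} (hh : 0 < h) (hK : K ≤ 0) (hσ : 0 ≤ σ)
    (hs : -K * h ^ 2 ≤ 4) {v : ℤ → ℤ → ℤ → ℝ} {j k : ℤ} (hP : 0 ≤ P) (hv : v 0 j k = P)
    (H : BlockLE v P 0 j k) : opRobin h K σ v j k ≤ 0 := by
  have hb : 0 ≤ 1 / (6 * h ^ 2) := by positivity
  have ha : 0 ≤ 1 / (3 * h ^ 2) + K / 12 := by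
    have : 1 / (3 * h ^ 2) + K / 12 = (4 + K * h ^ 2) / (12 * h ^ 2) := by field_simp; ring
    rw [this]; apply div_nonneg <;> nlinarith
  have e : opRobin h K σ v j k = -(4 / h ^ 2) * P - (2 * σ / h) * P + K / 12 * (6 + 2 * h * σ) * P
      + (1 / (3 * h ^ 2) + K / 12) * (v 0 (j + 1) k + v 0 (j - 1) k + v 0 j (k + 1)
        + v 0 j (k - 1) + 2 * v 1 j k)
      + 1 / (6 * h ^ 2) * (v 0 (j + 1) (k + 1) + v 0 (j + 1) (k - 1) + v 0 (j - 1) (k + 1)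
        + v 0 (j - 1) (k - 1) + 2 * (v 1 (j + 1) k + v 1 (j - 1) k + v 1 j (k + 1)
        + v 1 j (k - 1))) := by
    rw [← hv, opRobin, robinLap]; field_simp; ring
  have h1 : v 0 (j + 1) k + v 0 (j - 1) k + v 0 j (k + 1) + v 0 j (k - 1) + 2 * v 1 j k
      ≤ 6 * P := by
    have := H 0 (j + 1) k (by lia) (by lia) (by lia) (by lia) (by lia) (by lia) (by lia)
    have := H 0 (j - 1) k (by lia) (by lia) (by lia) (by lia) (by lia) (by lia) (by lia)
    have := H 0 j (k + 1) (by lia) (by lia) (by lia) (by lia) (by lia) (by lia) (by lia)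
    have := H 0 j (k - 1) (by lia) (by lia) (by lia) (by lia) (by lia) (by lia) (by lia)
    have := H 1 j k (by lia) (by lia) (by lia) (by lia) (by lia) (by lia) (by lia)
    linarith
  have h2 : v 0 (j + 1) (k + 1) + v 0 (j + 1) (k - 1) + v 0 (j - 1) (k + 1)
        + v 0 (j - 1) (k - 1) + 2 * (v 1 (j + 1) k + v 1 (j - 1) k + v 1 j (k + 1)
        + v 1 j (k - 1)) ≤ 12 * P := by
    have := H 0 (j + 1) (k + 1) (by lia) (by lia) (by lia) (by lia) (by lia) (by lia) (by lia)
    have := H 0 (j + 1) (k - 1) (by lia) (by lia) (by lia) (by lia) (by lia) (by lia) (by lia)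
    have := H 0 (j - 1) (k + 1) (by lia) (by lia) (by lia) (by lia) (by lia) (by lia) (by lia)
    have := H 0 (j - 1) (k - 1) (by lia) (by lia) (by lia) (by lia) (by lia) (by lia) (by lia)
    have := H 1 (j + 1) k (by lia) (by lia) (by lia) (by lia) (by lia) (by lia) (by lia)
    have := H 1 (j - 1) k (by lia) (by lia) (by lia) (by lia) (by lia) (by lia) (by lia)
    have := H 1 j (k + 1) (by lia) (by lia) (by lia) (by lia) (by lia) (by lia) (by lia)
    have := H 1 j (k - 1) (by lia) (by lia) (by lia) (by lia) (by lia) (by lia) (by lia)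
    linarith
  have h3 := mul_le_mul_of_nonneg_left h1 ha
  have h4 := mul_le_mul_of_nonneg_left h2 hb
  have h5 : -(4 / h ^ 2) * P + K / 12 * (6 + 2 * h * σ) * P
      + (1 / (3 * h ^ 2) + K / 12) * (6 * P)
      + 1 / (6 * h ^ 2) * (12 * P) = K * (P * (1 + h * σ / 6)) := by field_simp; ring
  have h6 : K * (P * (1 + h * σ / 6)) ≤ 0 := mul_nonpos_of_nonpos_of_nonneg hK (by positivity)
  have h7 : 0 ≤ (2 * σ / h) * P := by positivity
  linarith

/-- Diagonal dominance on coarse meshes. -/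
theorem opInt_le_of_blockLE_coarse {h K P : ℝ} (hh : 0 < h)
    (hs : 4 ≤ -K * h ^ 2) {v : ℤ → ℤ → ℤ → ℝ} {i j k : ℤ} (hi : 0 < i) (hv : v i j k = P)
    (H : BlockLE v P i j k) (H' : BlockLE (fun a b c => -v a b c) P i j k) :
    opInt h K v i j k ≤ -(4 / h ^ 2) * P := by
  have hb : 0 ≤ 1 / (6 * h ^ 2) := by positivity
  have ha : 0 ≤ -(1 / (3 * h ^ 2) + K / 12) := by
    have : -(1 / (3 * h ^ 2) + K / 12) = (-K * h ^ 2 - 4) / (12 * h ^ 2) := by field_simp; ring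
    rw [this]; apply div_nonneg <;> nlinarith
  have e : opInt h K v i j k = -(4 / h ^ 2) * P + K / 2 * P
      + -(1 / (3 * h ^ 2) + K / 12) * (-v (i + 1) j k + -v (i - 1) j k + -v i (j + 1) k
        + -v i (j - 1) k + -v i j (k + 1) + -v i j (k - 1))
      + 1 / (6 * h ^ 2) * (v (i + 1) (j + 1) k + v (i + 1) (j - 1) k + v (i - 1) (j + 1) k
        + v (i - 1) (j - 1) k + v (i + 1) j (k + 1) + v (i + 1) j (k - 1) + v (i - 1) j (k + 1)
        + v (i - 1) j (k - 1) + v i (j + 1) (k + 1) + v i (j - 1) (k + 1) + v i (j + 1) (k - 1)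
        + v i (j - 1) (k - 1)) := by
    rw [← hv, opInt, lap19, avg7]; ring
  have h1 : -v (i + 1) j k + -v (i - 1) j k + -v i (j + 1) k
        + -v i (j - 1) k + -v i j (k + 1) + -v i j (k - 1) ≤ 6 * P := by
    have := H' (i + 1) j k (by lia) (by lia) (by lia) (by lia) (by lia) (by lia) (by lia)
    have := H' (i - 1) j k (by lia) (by lia) (by lia) (by lia) (by lia) (by lia) (by lia)
    have := H' i (j + 1) k (by lia) (by lia) (by lia) (by lia) (by lia) (by lia) (by lia)
    have := H' i (j - 1) k (by lia) (by lia) (by lia) (by lia) (by lia) (by lia) (by lia)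
    have := H' i j (k + 1) (by lia) (by lia) (by lia) (by lia) (by lia) (by lia) (by lia)
    have := H' i j (k - 1) (by lia) (by lia) (by lia) (by lia) (by lia) (by lia) (by lia)
    linarith
  have h2 : v (i + 1) (j + 1) k + v (i + 1) (j - 1) k + v (i - 1) (j + 1) k
        + v (i - 1) (j - 1) k + v (i + 1) j (k + 1) + v (i + 1) j (k - 1) + v (i - 1) j (k + 1)
        + v (i - 1) j (k - 1) + v i (j + 1) (k + 1) + v i (j - 1) (k + 1) + v i (j + 1) (k - 1)
        + v i (j - 1) (k - 1) ≤ 12 * P := by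
    have := H (i + 1) (j + 1) k (by lia) (by lia) (by lia) (by lia) (by lia) (by lia) (by lia)
    have := H (i + 1) (j - 1) k (by lia) (by lia) (by lia) (by lia) (by lia) (by lia) (by lia)
    have := H (i - 1) (j + 1) k (by lia) (by lia) (by lia) (by lia) (by lia) (by lia) (by lia)
    have := H (i - 1) (j - 1) k (by lia) (by lia) (by lia) (by lia) (by lia) (by lia) (by lia)
    have := H (i + 1) j (k + 1) (by lia) (by lia) (by lia) (by lia) (by lia) (by lia) (by lia)
    have := H (i + 1) j (k - 1) (by lia) (by lia) (by lia) (by lia) (by lia) (by lia) (by lia)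
    have := H (i - 1) j (k + 1) (by lia) (by lia) (by lia) (by lia) (by lia) (by lia) (by lia)
    have := H (i - 1) j (k - 1) (by lia) (by lia) (by lia) (by lia) (by lia) (by lia) (by lia)
    have := H i (j + 1) (k + 1) (by lia) (by lia) (by lia) (by lia) (by lia) (by lia) (by lia)
    have := H i (j - 1) (k + 1) (by lia) (by lia) (by lia) (by lia) (by lia) (by lia) (by lia)
    have := H i (j + 1) (k - 1) (by lia) (by lia) (by lia) (by lia) (by lia) (by lia) (by lia)
    have := H i (j - 1) (k - 1) (by lia) (by lia) (by lia) (by lia) (by lia) (by lia) (by lia)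
    linarith
  have h3 := mul_le_mul_of_nonneg_left h1 ha
  have h4 := mul_le_mul_of_nonneg_left h2 hb
  -- The absolute off-diagonal sum is exactly `-K/2`; it is absorbed by the `K` part of the
  -- diagonal, and `4/h²` survives as margin.
  have h5 : K / 2 * P + -(1 / (3 * h ^ 2) + K / 12) * (6 * P)
      + 1 / (6 * h ^ 2) * (12 * P) = 0 := by field_simp; ring
  linarith

/-- The dominance persists at the Robin face because the extra diagonal terms `-2σ/h` and `K h σ/6`
are nonpositive. -/
theorem opRobin_le_of_blockLE_coarse {h K σ P : ℝ} (hh : 0 < h) (hK : K ≤ 0) (hσ : 0 ≤ σ)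
    (hs : 4 ≤ -K * h ^ 2) {v : ℤ → ℤ → ℤ → ℝ} {j k : ℤ} (hP : 0 ≤ P) (hv : v 0 j k = P)
    (H : BlockLE v P 0 j k) (H' : BlockLE (fun a b c => -v a b c) P 0 j k) :
    opRobin h K σ v j k ≤ -(4 / h ^ 2) * P := by
  have hb : 0 ≤ 1 / (6 * h ^ 2) := by positivity
  have ha : 0 ≤ -(1 / (3 * h ^ 2) + K / 12) := by
    have : -(1 / (3 * h ^ 2) + K / 12) = (-K * h ^ 2 - 4) / (12 * h ^ 2) := by field_simp; ring
    rw [this]; apply div_nonneg <;> nlinarith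
  have e : opRobin h K σ v j k = -(4 / h ^ 2) * P - (2 * σ / h) * P + K / 12 * (6 + 2 * h * σ) * P
      + -(1 / (3 * h ^ 2) + K / 12) * (-v 0 (j + 1) k + -v 0 (j - 1) k + -v 0 j (k + 1)
        + -v 0 j (k - 1) + 2 * -v 1 j k)
      + 1 / (6 * h ^ 2) * (v 0 (j + 1) (k + 1) + v 0 (j + 1) (k - 1) + v 0 (j - 1) (k + 1)
        + v 0 (j - 1) (k - 1) + 2 * (v 1 (j + 1) k + v 1 (j - 1) k + v 1 j (k + 1)
        + v 1 j (k - 1))) := by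
    rw [← hv, opRobin, robinLap]; field_simp; ring
  have h1 : -v 0 (j + 1) k + -v 0 (j - 1) k + -v 0 j (k + 1) + -v 0 j (k - 1) + 2 * -v 1 j k
      ≤ 6 * P := by
    have := H' 0 (j + 1) k (by lia) (by lia) (by lia) (by lia) (by lia) (by lia) (by lia)
    have := H' 0 (j - 1) k (by lia) (by lia) (by lia) (by lia) (by lia) (by lia) (by lia)
    have := H' 0 j (k + 1) (by lia) (by lia) (by lia) (by lia) (by lia) (by lia) (by lia)
    have := H' 0 j (k - 1) (by lia) (by lia) (by lia) (by lia) (by lia) (by lia) (by lia)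
    have := H' 1 j k (by lia) (by lia) (by lia) (by lia) (by lia) (by lia) (by lia)
    linarith
  have h2 : v 0 (j + 1) (k + 1) + v 0 (j + 1) (k - 1) + v 0 (j - 1) (k + 1)
        + v 0 (j - 1) (k - 1) + 2 * (v 1 (j + 1) k + v 1 (j - 1) k + v 1 j (k + 1)
        + v 1 j (k - 1)) ≤ 12 * P := by
    have := H 0 (j + 1) (k + 1) (by lia) (by lia) (by lia) (by lia) (by lia) (by lia) (by lia)
    have := H 0 (j + 1) (k - 1) (by lia) (by lia) (by lia) (by lia) (by lia) (by lia) (by lia)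
    have := H 0 (j - 1) (k + 1) (by lia) (by lia) (by lia) (by lia) (by lia) (by lia) (by lia)
    have := H 0 (j - 1) (k - 1) (by lia) (by lia) (by lia) (by lia) (by lia) (by lia) (by lia)
    have := H 1 (j + 1) k (by lia) (by lia) (by lia) (by lia) (by lia) (by lia) (by lia)
    have := H 1 (j - 1) k (by lia) (by lia) (by lia) (by lia) (by lia) (by lia) (by lia)
    have := H 1 j (k + 1) (by lia) (by lia) (by lia) (by lia) (by lia) (by lia) (by lia)
    have := H 1 j (k - 1) (by lia) (by lia) (by lia) (by lia) (by lia) (by lia) (by lia)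
    linarith
  have h3 := mul_le_mul_of_nonneg_left h1 ha
  have h4 := mul_le_mul_of_nonneg_left h2 hb
  have h5 : K / 12 * (6 + 2 * h * σ) * P + -(1 / (3 * h ^ 2) + K / 12) * (6 * P)
      + 1 / (6 * h ^ 2) * (12 * P) = K * (P * (h * σ / 6)) := by field_simp; ring
  have h6 : K * (P * (h * σ / 6)) ≤ 0 := mul_nonpos_of_nonpos_of_nonneg hK (by positivity)
  have h7 : 0 ≤ (2 * σ / h) * P := by positivity
  linarith

theorem opInt_comb (h K s : ℝ) (v w : ℤ → ℤ → ℤ → ℝ) (i j k : ℤ) :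
    opInt h K (fun a b c => v a b c + s * w a b c) i j k
      = opInt h K v i j k + s * opInt h K w i j k := by
  simp only [opInt, lap19, avg7]; ring

theorem opRobin_comb (h K σ s : ℝ) (v w : ℤ → ℤ → ℤ → ℝ) (j k : ℤ) :
    opRobin h K σ (fun a b c => v a b c + s * w a b c) j k
      = opRobin h K σ v j k + s * opRobin h K σ w j k := by
  simp only [opRobin, robinLap]; ring

theorem opInt_neg (h K : ℝ) (v : ℤ → ℤ → ℤ → ℝ) (i j k : ℤ) :
    opInt h K (fun a b c => -v a b c) i j k = -opInt h K v i j k := by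
  simp only [opInt, lap19, avg7]; ring

theorem opRobin_neg (h K σ : ℝ) (v : ℤ → ℤ → ℤ → ℝ) (j k : ℤ) :
    opRobin h K σ (fun a b c => -v a b c) j k = -opRobin h K σ v j k := by
  simp only [opRobin, robinLap]; ring

/-! ### Barrier function and stability in the maximum norm -/

/-- The barrier `L + L²/2 - X - X²/2` with `X = x - xl`. -/
noncomputable def barrier (h L : ℝ) (i _j _k : ℤ) : ℝ :=
  L + L ^ 2 / 2 - i * h - (i * h) ^ 2 / 2

theorem barrier_nonneg {h L : ℝ} (hh : 0 < h) {i j k : ℤ} (hi : 0 ≤ i) (hL : i * h ≤ L) :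
    0 ≤ barrier h L i j k := by
  have h1 : (0 : ℝ) ≤ i * h := by positivity
  rw [barrier]; nlinarith

theorem barrier_le {h L : ℝ} (hh : 0 < h) {i j k : ℤ} (hi : 0 ≤ i) :
    barrier h L i j k ≤ L + L ^ 2 / 2 := by
  have h1 : (0 : ℝ) ≤ i * h := by positivity
  rw [barrier]; nlinarith

/-- The 19-point Laplacian of this quadratic is its second derivative `-1`; the `K` term helps,
because the barrier is nonnegative on the three layers involved. -/
theorem opInt_barrier {h K L : ℝ} (hh : 0 < h) (hK : K ≤ 0) {i j k : ℤ} (hi : 0 < i)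
    (hL : (i + 1 : ℤ) * h ≤ L) : opInt h K (barrier h L) i j k ≤ -1 := by
  have h1 : lap19 h (barrier h L) i j k = -1 := by
    simp only [lap19, barrier]; push_cast; field_simp; ring
  have hL0 : (i : ℝ) * h ≤ L := by push_cast at hL; linarith
  have hL1 : ((i - 1 : ℤ) : ℝ) * h ≤ L := by push_cast; linarith
  have h2 : 0 ≤ avg7 (barrier h L) i j k := by
    have a1 := fun b c => barrier_nonneg hh (j := b) (k := c) (by lia : 0 ≤ i + 1) hL
    have a2 := fun b c => barrier_nonneg hh (j := b) (k := c) hi.le hL0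
    have a3 := fun b c => barrier_nonneg hh (j := b) (k := c) (by lia : 0 ≤ i - 1) hL1
    rw [avg7]
    have := a1 j k; have := a2 j k; have := a3 j k
    have := a2 (j + 1) k; have := a2 (j - 1) k; have := a2 j (k + 1); have := a2 j (k - 1)
    linarith
  rw [opInt, h1]
  linarith [mul_nonpos_of_nonpos_of_nonneg hK h2]

/-- The slope of the barrier at the face is `-1`, and the stencil weighs the outward normal
derivative by `-2/h`. This is the source of the tolerance `s / h` for boundary residuals. -/
theorem opRobin_barrier {h K σ L : ℝ} (hh : 0 < h) (hK : K ≤ 0) (hσ : 0 ≤ σ) {j k : ℤ}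
    (hL : h ≤ L) : opRobin h K σ (barrier h L) j k ≤ -(2 / h) := by
  have h0 : ∀ b c, 0 ≤ barrier h L 0 b c :=
    fun b c => barrier_nonneg hh le_rfl (by simp; linarith)
  have h1 : ∀ b c, 0 ≤ barrier h L 1 b c :=
    fun b c => barrier_nonneg hh (by norm_num) (by simpa using hL)
  have e : robinLap h σ (barrier h L) j k = -(2 / h) - 1 - 2 * σ / h * barrier h L 0 j k := by
    simp only [robinLap, barrier]; push_cast; field_simp; ring
  rw [opRobin, e]
  have h2 : 0 ≤ 2 * σ / h * barrier h L 0 j k := mul_nonneg (by positivity) (h0 j k)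
  have h3 : 0 ≤ (6 + 2 * h * σ) * barrier h L 0 j k := mul_nonneg (by positivity) (h0 j k)
  have h4 : K / 12 * ((6 + 2 * h * σ) * barrier h L 0 j k
    + (barrier h L 0 (j + 1) k + barrier h L 0 (j - 1) k + barrier h L 0 j (k + 1)
      + barrier h L 0 j (k - 1)) + 2 * barrier h L 1 j k) ≤ 0 := by
    apply mul_nonpos_of_nonpos_of_nonneg (by linarith)
    have := h0 (j + 1) k; have := h0 (j - 1) k; have := h0 j (k + 1); have := h0 j (k - 1)
    have := h1 j k
    linarith
  linarith

namespace Mesh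

variable {B : Box}

/-- The grid indices of Dirichlet points. -/
def IsDirichletIndex (m : Mesh B) (i j k : ℤ) : Prop :=
  m.IsGridIndex i j k ∧ (i = m.Nx ∨ j = 0 ∨ j = m.Ny ∨ k = 0 ∨ k = m.Nz)

theorem exists_max (m : Mesh B) (v : ℤ → ℤ → ℤ → ℝ) : ∃ i j k, m.IsGridIndex i j k ∧
    ∀ a b c, m.IsGridIndex a b c → v a b c ≤ v i j k := by
  obtain ⟨⟨i, j, k⟩, hm, H⟩ := (Finset.Icc (0 : ℤ) m.Nx ×ˢ Finset.Icc (0 : ℤ) m.Ny ×ˢ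
    Finset.Icc (0 : ℤ) m.Nz).exists_max_image (fun q => v q.1 q.2.1 q.2.2) ⟨(0, 0, 0), by simp⟩
  simp only [Finset.mem_product, Finset.mem_Icc] at hm H
  exact ⟨i, j, k, hm, fun a b c h => H (a, b, c) h⟩

theorem index_cases (m : Mesh B) {i j k : ℤ} (h : m.IsGridIndex i j k) :
    m.IsDirichletIndex i j k ∨ (0 < j ∧ j < m.Ny ∧ 0 < k ∧ k < m.Nz) ∧
      (i = 0 ∧ 0 < m.Nx ∨ 0 < i ∧ i < m.Nx) := by
  unfold IsDirichletIndex
  by_cases h' : i = m.Nx ∨ j = 0 ∨ j = m.Ny ∨ k = 0 ∨ k = m.Nz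
  · exact Or.inl ⟨h, h'⟩
  · unfold IsGridIndex at h
    right; lia

theorem blockLE_of_grid (m : Mesh B) {v : ℤ → ℤ → ℤ → ℝ} {P : ℝ}
    (H : ∀ a b c, m.IsGridIndex a b c → v a b c ≤ P) {i j k : ℤ} (hi : i < m.Nx)
    (hj : 0 < j) (hj' : j < m.Ny) (hk : 0 < k) (hk' : k < m.Nz) : BlockLE v P i j k :=
  fun a b c _ _ _ _ _ _ _ => H a b c (by unfold IsGridIndex; lia)

theorem mul_h_le (m : Mesh B) {i : ℤ} (hi : i ≤ m.Nx) : i * m.h ≤ B.xr - B.xl := by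
  have h1 := m.hNx
  have h2 : (i : ℝ) ≤ m.Nx := by exact_mod_cast hi
  nlinarith [m.h_pos]

theorem Nx_pos (m : Mesh B) : 0 < m.Nx := by
  rcases Nat.eq_zero_or_pos m.Nx with h | h
  · have := m.hNx; have := B.hx; simp [h] at *; linarith
  · exact h

theorem h_le (m : Mesh B) : m.h ≤ B.xr - B.xl := by
  have := m.mul_h_le (i := 1) (by have := m.Nx_pos; lia)
  simpa using this

/-- At a positive maximum of `v - t * barrier` the maximum principle makes the operator nonpositive,
while the residual and barrier bounds make it positive. The strict inequality `s < t` gives the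
contradiction without a strong maximum principle. -/
theorem le_barrier (m : Mesh B) {K σ s t : ℝ} (hK : K ≤ 0) (hσ : 0 ≤ σ)
    (hc : -K * m.h ^ 2 ≤ 4) {v : ℤ → ℤ → ℤ → ℝ} (hs : 0 ≤ s) (hst : s < t)
    (hD : ∀ i j k, m.IsDirichletIndex i j k → v i j k = 0)
    (hI : ∀ i j k : ℤ, 0 < i → i < m.Nx → 0 < j → j < m.Ny → 0 < k → k < m.Nz →
      -s ≤ opInt m.h K v i j k)
    (hR : ∀ j k : ℤ, 0 < j → j < m.Ny → 0 < k → k < m.Nz → -s / m.h ≤ opRobin m.h K σ v j k)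
    {a b c : ℤ} (habc : m.IsGridIndex a b c) :
    v a b c ≤ t * barrier m.h (B.xr - B.xl) a b c := by
  have hh := m.h_pos
  have ht : 0 < t := by linarith
  obtain ⟨i, j, k, hg, H⟩ := m.exists_max
    (fun i j k => v i j k + -t * barrier m.h (B.xr - B.xl) i j k)
  have hφ : 0 ≤ barrier m.h (B.xr - B.xl) i j k :=
    barrier_nonneg hh hg.1.1 (m.mul_h_le hg.1.2)
  suffices h : v i j k + -t * barrier m.h (B.xr - B.xl) i j k ≤ 0 by
    have := H a b c habc
    linarith
  by_contra! hpos
  rcases m.index_cases hg with hd | ⟨⟨hj, hj', hk, hk'⟩, ⟨rfl, hi⟩ | ⟨hi, hi'⟩⟩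
  · rw [hD i j k hd] at hpos
    nlinarith
  · have h1 := opRobin_le_of_blockLE hh hK hσ hc hpos.le rfl
      (m.blockLE_of_grid H (by exact_mod_cast hi) hj hj' hk hk')
    rw [opRobin_comb] at h1
    have h2 := hR j k hj hj' hk hk'
    have h3 := opRobin_barrier hh hK hσ (j := j) (k := k) m.h_le
    have h4 : s / m.h < t * (2 / m.h) := by
      rw [mul_div_assoc', div_lt_div_iff_of_pos_right hh]; linarith
    rw [neg_div] at h2
    nlinarith
  · have h1 := opInt_le_of_blockLE hh hK hc hi hpos.le rfl
      (m.blockLE_of_grid H hi' hj hj' hk hk')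
    rw [opInt_comb] at h1
    have h2 := hI i j k hi hi' hj hj' hk hk'
    have h3 := opInt_barrier hh hK (j := j) (k := k) hi (m.mul_h_le (i := i + 1) (by lia))
    nlinarith

/-- At a maximum of `|v|` with `v = |v|`, dominance gives `v ≤ s h²/4` inside and `v ≤ s h/4` on the
face; `h ≤ xr - xl` puts both below the bound that the barrier gives on fine meshes. -/
theorem le_of_coarse (m : Mesh B) {K σ s : ℝ} (hK : K ≤ 0) (hσ : 0 ≤ σ)
    (hc : 4 ≤ -K * m.h ^ 2) {v : ℤ → ℤ → ℤ → ℝ} (hs : 0 ≤ s)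
    (hD : ∀ i j k, m.IsDirichletIndex i j k → v i j k = 0)
    (hI : ∀ i j k : ℤ, 0 < i → i < m.Nx → 0 < j → j < m.Ny → 0 < k → k < m.Nz →
      -s ≤ opInt m.h K v i j k)
    (hR : ∀ j k : ℤ, 0 < j → j < m.Ny → 0 < k → k < m.Nz → -s / m.h ≤ opRobin m.h K σ v j k)
    {i j k : ℤ} (hg : m.IsGridIndex i j k)
    (H : ∀ a b c, m.IsGridIndex a b c → |v a b c| ≤ v i j k) :
    v i j k ≤ s * ((B.xr - B.xl) + (B.xr - B.xl) ^ 2 / 2) := by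
  have hh := m.h_pos
  have hL := m.h_le
  have hP : 0 ≤ v i j k := (abs_nonneg _).trans (H i j k hg)
  have H1 : ∀ a b c, m.IsGridIndex a b c → v a b c ≤ v i j k :=
    fun a b c h => (le_abs_self _).trans (H a b c h)
  have H2 : ∀ a b c, m.IsGridIndex a b c → -v a b c ≤ v i j k :=
    fun a b c h => (neg_le_abs _).trans (H a b c h)
  rcases m.index_cases hg with hd | ⟨⟨hj, hj', hk, hk'⟩, ⟨rfl, hi⟩ | ⟨hi, hi'⟩⟩
  · rw [hD i j k hd]
    have : 0 ≤ B.xr - B.xl := by linarith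
    positivity
  · have hi0 : (0 : ℤ) < m.Nx := by exact_mod_cast hi
    have h1 := opRobin_le_of_blockLE_coarse hh hK hσ hc hP rfl
      (m.blockLE_of_grid H1 hi0 hj hj' hk hk')
      (m.blockLE_of_grid (v := fun a b c => -v a b c) H2 hi0 hj hj' hk hk')
    have h2 := hR j k hj hj' hk hk'
    have h3 : 4 / m.h ^ 2 * v 0 j k ≤ s / m.h := by rw [neg_div] at h2; linarith
    have h4 : 4 * v 0 j k ≤ s * m.h := by
      have := mul_le_mul_of_nonneg_right h3 (sq_nonneg m.h)
      have e1 : 4 / m.h ^ 2 * v 0 j k * m.h ^ 2 = 4 * v 0 j k := by field_simp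
      have e2 : s / m.h * m.h ^ 2 = s * m.h := by field_simp
      rwa [e1, e2] at this
    nlinarith [mul_le_mul_of_nonneg_left hL hs, mul_nonneg hs (sq_nonneg (B.xr - B.xl))]
  · have h1 := opInt_le_of_blockLE_coarse hh hc hi rfl
      (m.blockLE_of_grid H1 hi' hj hj' hk hk')
      (m.blockLE_of_grid (v := fun a b c => -v a b c) H2 hi' hj hj' hk hk')
    have h2 := hI i j k hi hi' hj hj' hk hk'
    have h3 : 4 / m.h ^ 2 * v i j k ≤ s := by linarith
    have h4 : 4 * v i j k ≤ s * m.h ^ 2 := by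
      have := mul_le_mul_of_nonneg_right h3 (sq_nonneg m.h)
      have e1 : 4 / m.h ^ 2 * v i j k * m.h ^ 2 = 4 * v i j k := by field_simp
      rwa [e1] at this
    have h5 : m.h ^ 2 ≤ (B.xr - B.xl) ^ 2 := pow_le_pow_left₀ hh.le hL 2
    nlinarith [mul_le_mul_of_nonneg_left h5 hs, mul_nonneg hs (hh.le.trans hL),
      mul_nonneg hs (sq_nonneg (B.xr - B.xl))]

/-- Stability of the scheme in the maximum norm, on every mesh. -/
theorem stability (m : Mesh B) {K σ s : ℝ} (hK : K ≤ 0) (hσ : 0 ≤ σ)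
    {v : ℤ → ℤ → ℤ → ℝ} (hs : 0 ≤ s)
    (hD : ∀ i j k, m.IsDirichletIndex i j k → v i j k = 0)
    (hI : ∀ i j k : ℤ, 0 < i → i < m.Nx → 0 < j → j < m.Ny → 0 < k → k < m.Nz →
      |opInt m.h K v i j k| ≤ s)
    (hR : ∀ j k : ℤ, 0 < j → j < m.Ny → 0 < k → k < m.Nz → |opRobin m.h K σ v j k| ≤ s / m.h)
    {a b c : ℤ} (habc : m.IsGridIndex a b c) :
    |v a b c| ≤ s * ((B.xr - B.xl) + (B.xr - B.xl) ^ 2 / 2) := by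
  have hh := m.h_pos
  have hL := m.h_le
  have hL0 : 0 ≤ B.xr - B.xl := by linarith
  have hD' : ∀ i j k, m.IsDirichletIndex i j k → -v i j k = 0 := fun i j k h => by
    rw [hD i j k h, neg_zero]
  have hI1 : ∀ i j k : ℤ, 0 < i → i < m.Nx → 0 < j → j < m.Ny → 0 < k → k < m.Nz →
      -s ≤ opInt m.h K v i j k := fun i j k h1 h2 h3 h4 h5 h6 =>
    (abs_le.1 (hI i j k h1 h2 h3 h4 h5 h6)).1
  have hI2 : ∀ i j k : ℤ, 0 < i → i < m.Nx → 0 < j → j < m.Ny → 0 < k → k < m.Nz →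
      -s ≤ opInt m.h K (fun a b c => -v a b c) i j k := fun i j k h1 h2 h3 h4 h5 h6 => by
    rw [opInt_neg]; linarith [(abs_le.1 (hI i j k h1 h2 h3 h4 h5 h6)).2]
  have hR1 : ∀ j k : ℤ, 0 < j → j < m.Ny → 0 < k → k < m.Nz →
      -s / m.h ≤ opRobin m.h K σ v j k := fun j k h3 h4 h5 h6 => by
    rw [neg_div]; exact (abs_le.1 (hR j k h3 h4 h5 h6)).1
  have hR2 : ∀ j k : ℤ, 0 < j → j < m.Ny → 0 < k → k < m.Nz →
      -s / m.h ≤ opRobin m.h K σ (fun a b c => -v a b c) j k := fun j k h3 h4 h5 h6 => by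
    rw [opRobin_neg, neg_div]; linarith [(abs_le.1 (hR j k h3 h4 h5 h6)).2]
  rcases le_total (-K * m.h ^ 2) 4 with hc | hc
  · have key : ∀ t > s, |v a b c| ≤ t * ((B.xr - B.xl) + (B.xr - B.xl) ^ 2 / 2) := by
      intro t ht
      have h1 := m.le_barrier hK hσ hc hs ht hD hI1 hR1 habc
      have h2 := m.le_barrier hK hσ hc hs ht hD' hI2 hR2 habc
      have h3 := mul_le_mul_of_nonneg_left
        (barrier_le (L := B.xr - B.xl) hh (i := a) (j := b) (k := c) habc.1.1) (hs.trans ht.le)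
      exact abs_le.2 ⟨by linarith, by linarith⟩
    -- Let `t` decrease to `s`.
    apply le_of_forall_pos_le_add
    intro ε hε
    have hpos : 0 < (B.xr - B.xl) + (B.xr - B.xl) ^ 2 / 2 := by
      have := B.hx; have : 0 < B.xr - B.xl := by linarith
      positivity
    refine (key (s + ε / ((B.xr - B.xl) + (B.xr - B.xl) ^ 2 / 2))
      (by linarith [div_pos hε hpos])).trans (le_of_eq ?_)
    rw [add_mul, div_mul_cancel₀ _ hpos.ne']
  · obtain ⟨i, j, k, hg, H⟩ := m.exists_max (fun i j k => |v i j k|)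
    refine (H a b c habc).trans ?_
    rcases abs_choice (v i j k) with h | h
    · simp only [h] at H ⊢
      exact m.le_of_coarse hK hσ hc hs hD hI1 hR1 hg H
    · simp only [h] at H ⊢
      exact m.le_of_coarse (v := fun a b c => -v a b c) hK hσ hc hs hD' hI2 hR2 hg
        (fun a b c h => by simpa using H a b c h)

end Mesh

end RobinHOC

/-! ### Existence and uniqueness of the discrete solution -/

namespace RobinHOC

variable {B : Box}

/-- The data side of the boundary equations. -/
noncomputable def rhsRobin (m : Mesh B) (K : ℝ) (f : ℝ × ℝ × ℝ → ℝ) (fext : ℤ → ℤ → ℝ)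
    (g : ℝ → ℝ → ℝ) (j k : ℤ) : ℝ :=
  1 / 12 * (6 * m.sample f 0 j k + m.sample f 0 (j + 1) k + m.sample f 0 (j - 1) k
    + m.sample f 0 j (k + 1) + m.sample f 0 j (k - 1) - fext j k + 3 * m.sample f 1 j k)
  + (K * m.h / 6 - 2 / m.h) * g (m.y j) (m.z k)

theorem interior_iff (m : Mesh B) (K σ : ℝ) (f : ℝ × ℝ × ℝ → ℝ) (fext : ℤ → ℤ → ℝ)
    (g : ℝ → ℝ → ℝ) (U : ℤ → ℤ → ℤ → ℝ) {i j k : ℤ} (hi : 0 < i) :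
    lap19 m.h U i j k = avg7 (source m K σ f fext g U) i j k ↔
      opInt m.h K U i j k = avg7 (m.sample f) i j k := by
  have e : avg7 (source m K σ f fext g U) i j k
      = avg7 (m.sample f) i j k - K * avg7 U i j k := by
    simp only [avg7, source, if_neg (by lia : ¬ i = -1), if_neg (by lia : ¬ i + 1 = -1),
      if_neg (by lia : ¬ i - 1 = -1)]
    ring
  rw [e, opInt, eq_sub_iff_add_eq]

/-- Substituting the ghost value leaves weight `3 - 1 = 2` on `U 1`, adds `2hσ` to the weight of `U
0`, and sends `K h g / 6` to the data side. -/
theorem robin_iff (m : Mesh B) (K σ : ℝ) (f : ℝ × ℝ × ℝ → ℝ) (fext : ℤ → ℤ → ℝ)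
    (g : ℝ → ℝ → ℝ) (U : ℤ → ℤ → ℤ → ℝ) (j k : ℤ) :
    robinLap m.h σ U j k =
      robinAvg (source m K σ f fext g U) j k + -2 / m.h * g (m.y j) (m.z k) ↔
      opRobin m.h K σ U j k = rhsRobin m K f fext g j k := by
  have e : robinAvg (source m K σ f fext g U) j k + -2 / m.h * g (m.y j) (m.z k)
      = rhsRobin m K f fext g j k - (opRobin m.h K σ U j k - robinLap m.h σ U j k) := by
    simp only [robinAvg, source, if_neg (by norm_num : ¬ (0 : ℤ) = -1),
      if_neg (by norm_num : ¬ (1 : ℤ) = -1), if_true, ghost, rhsRobin, opRobin]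
    ring
  rw [e]
  constructor <;> intro h <;> linarith

theorem isFDSolution_iff (m : Mesh B) (K σ : ℝ) (f : ℝ × ℝ × ℝ → ℝ) (fext : ℤ → ℤ → ℝ)
    (u₁ : ℝ × ℝ × ℝ → ℝ) (g : ℝ → ℝ → ℝ) (U : ℤ → ℤ → ℤ → ℝ) :
    IsFDSolution m K σ f fext u₁ g U ↔
      (∀ i j k : ℤ, 0 < i → i < m.Nx → 0 < j → j < m.Ny → 0 < k → k < m.Nz →
        opInt m.h K U i j k = avg7 (m.sample f) i j k) ∧
      (∀ j k : ℤ, 0 < j → j < m.Ny → 0 < k → k < m.Nz →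
        opRobin m.h K σ U j k = rhsRobin m K f fext g j k) ∧
      (∀ i j k : ℤ, m.IsDirichletIndex i j k → U i j k = m.sample u₁ i j k) := by
  constructor
  · rintro ⟨h1, h2, h3⟩
    exact ⟨fun i j k hi hi' hj hj' hk hk' =>
      (interior_iff m K σ f fext g U hi).1 (h1 i j k hi hi' hj hj' hk hk'),
      fun j k hj hj' hk hk' => (robin_iff m K σ f fext g U j k).1 (h2 j k hj hj' hk hk'),
      fun i j k h => h3 i j k h.1 h.2⟩
  · rintro ⟨h1, h2, h3⟩
    exact ⟨fun i j k hi hi' hj hj' hk hk' =>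
      (interior_iff m K σ f fext g U hi).2 (h1 i j k hi hi' hj hj' hk hk'),
      fun j k hj hj' hk hk' => (robin_iff m K σ f fext g U j k).2 (h2 j k hj hj' hk hk'),
      fun i j k h h' => h3 i j k ⟨h, h'⟩⟩

namespace Mesh

/-- The left-hand side of the scheme as one operator on grid functions. -/
noncomputable def op (m : Mesh B) (K σ : ℝ) (v : ℤ → ℤ → ℤ → ℝ) (i j k : ℤ) : ℝ :=
  open Classical in
  if m.IsDirichletIndex i j k then v i j k
  else if i = 0 then opRobin m.h K σ v j k else opInt m.h K v i j k

theorem op_comb (m : Mesh B) (K σ s : ℝ) (v w : ℤ → ℤ → ℤ → ℝ) (i j k : ℤ) :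
    m.op K σ (fun a b c => v a b c + s * w a b c) i j k
      = m.op K σ v i j k + s * m.op K σ w i j k := by
  unfold op; split_ifs
  · rfl
  · exact opRobin_comb ..
  · exact opInt_comb ..

theorem op_of_dirichlet (m : Mesh B) (K σ : ℝ) (v : ℤ → ℤ → ℤ → ℝ) {i j k : ℤ}
    (h : m.IsDirichletIndex i j k) : m.op K σ v i j k = v i j k := if_pos h

theorem op_of_robin (m : Mesh B) (K σ : ℝ) (v : ℤ → ℤ → ℤ → ℝ) {j k : ℤ} (hj : 0 < j)
    (hj' : j < m.Ny) (hk : 0 < k) (hk' : k < m.Nz) :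
    m.op K σ v 0 j k = opRobin m.h K σ v j k := by
  have := m.Nx_pos
  rw [op, if_neg (by unfold IsDirichletIndex; lia), if_pos rfl]

theorem op_of_interior (m : Mesh B) (K σ : ℝ) (v : ℤ → ℤ → ℤ → ℝ) {i j k : ℤ} (hi : 0 < i)
    (hi' : i < m.Nx) (hj : 0 < j) (hj' : j < m.Ny) (hk : 0 < k) (hk' : k < m.Nz) :
    m.op K σ v i j k = opInt m.h K v i j k := by
  rw [op, if_neg (by unfold IsDirichletIndex; lia), if_neg hi.ne']

theorem op_eq_zero (m : Mesh B) {K σ : ℝ} (hK : K ≤ 0) (hσ : 0 ≤ σ) {v : ℤ → ℤ → ℤ → ℝ}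
    (H : ∀ i j k, m.IsGridIndex i j k → m.op K σ v i j k = 0) {i j k : ℤ}
    (h : m.IsGridIndex i j k) : v i j k = 0 := by
  have := m.stability hK hσ (v := v) le_rfl
    (fun i j k hd => by rw [← m.op_of_dirichlet K σ v hd]; exact H i j k hd.1)
    (fun i j k hi hi' hj hj' hk hk' => by
      rw [← m.op_of_interior K σ v hi hi' hj hj' hk hk',
        H i j k ⟨⟨hi.le, hi'.le⟩, ⟨hj.le, hj'.le⟩, ⟨hk.le, hk'.le⟩⟩, abs_zero])
    (fun j k hj hj' hk hk' => by
      rw [← m.op_of_robin K σ v hj hj' hk hk',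
        H 0 j k ⟨⟨le_rfl, by lia⟩, ⟨hj.le, hj'.le⟩, ⟨hk.le, hk'.le⟩⟩, abs_zero, zero_div]) h
  rw [zero_mul] at this
  exact abs_nonpos_iff.1 this

/-- The set of grid indices. -/
noncomputable def grid (m : Mesh B) : Finset (ℤ × ℤ × ℤ) :=
  Finset.Icc (0 : ℤ) m.Nx ×ˢ Finset.Icc (0 : ℤ) m.Ny ×ˢ Finset.Icc (0 : ℤ) m.Nz

theorem mem_grid (m : Mesh B) {i j k : ℤ} : (i, j, k) ∈ m.grid ↔ m.IsGridIndex i j k := by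
  simp [grid, IsGridIndex]

/-- Extension by zero of a function on the grid. -/
noncomputable def extend (m : Mesh B) (w : m.grid → ℝ) (i j k : ℤ) : ℝ :=
  if h : (i, j, k) ∈ m.grid then w ⟨(i, j, k), h⟩ else 0

/-- The left-hand side of the scheme as a linear map. -/
noncomputable def opLin (m : Mesh B) (K σ : ℝ) : (m.grid → ℝ) →ₗ[ℝ] (m.grid → ℝ) where
  toFun w q := m.op K σ (m.extend w) q.1.1 q.1.2.1 q.1.2.2
  map_add' v w := by
    funext q
    have := m.op_comb K σ 1 (m.extend v) (m.extend w) q.1.1 q.1.2.1 q.1.2.2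
    rw [one_mul] at this
    rw [Pi.add_apply, ← this]
    congr 1
    funext a b c
    unfold extend; split_ifs <;> simp
  map_smul' s w := by
    funext q
    have := m.op_comb K σ s (fun _ _ _ => 0) (m.extend w) q.1.1 q.1.2.1 q.1.2.2
    -- The operator kills the zero function, seen as `w` plus `-1` times `w`.
    have h0 := m.op_comb K σ (-1) (m.extend w) (m.extend w) q.1.1 q.1.2.1 q.1.2.2
    simp only [neg_mul, one_mul, add_neg_cancel] at h0
    rw [h0, zero_add] at this
    simp only [RingHom.id_apply, Pi.smul_apply, smul_eq_mul]
    rw [← this]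
    congr 1
    funext a b c
    unfold extend; split_ifs <;> simp

/-- Stability with `s = 0` gives injectivity, and the domain and codomain are the same
finite-dimensional space. -/
theorem opLin_surjective (m : Mesh B) {K σ : ℝ} (hK : K ≤ 0) (hσ : 0 ≤ σ) :
    Function.Surjective (m.opLin K σ) := by
  rw [← LinearMap.injective_iff_surjective, injective_iff_map_eq_zero]
  intro w hw
  funext ⟨⟨i, j, k⟩, hq⟩
  have := m.op_eq_zero hK hσ (v := m.extend w)
    (fun a b c h => congrFun hw ⟨(a, b, c), m.mem_grid.2 h⟩) (m.mem_grid.1 hq)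
  rwa [extend, dif_pos hq] at this

end Mesh

/-- Existence is surjectivity of `opLin` for the combined data; uniqueness is stability with `s = 0`
for the difference of two solutions. -/
theorem exists_unique_fdSolution (m : Mesh B) {K σ : ℝ} (hK : K ≤ 0) (hσ : 0 ≤ σ)
    (f u₁ : ℝ × ℝ × ℝ → ℝ) (g : ℝ → ℝ → ℝ) (fext : ℤ → ℤ → ℝ) :
    ∃ U : ℤ → ℤ → ℤ → ℝ, IsFDSolution m K σ f fext u₁ g U ∧
      ∀ V : ℤ → ℤ → ℤ → ℝ, IsFDSolution m K σ f fext u₁ g V →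
        ∀ i j k : ℤ, m.IsGridIndex i j k → V i j k = U i j k := by
  classical
  obtain ⟨w, hw⟩ := m.opLin_surjective hK hσ (fun q =>
    if m.IsDirichletIndex q.1.1 q.1.2.1 q.1.2.2 then m.sample u₁ q.1.1 q.1.2.1 q.1.2.2
    else if q.1.1 = 0 then rhsRobin m K f fext g q.1.2.1 q.1.2.2
    else avg7 (m.sample f) q.1.1 q.1.2.1 q.1.2.2)
  have hU : ∀ i j k, m.IsGridIndex i j k → m.op K σ (m.extend w) i j k
      = if m.IsDirichletIndex i j k then m.sample u₁ i j k
        else if i = 0 then rhsRobin m K f fext g j k else avg7 (m.sample f) i j k :=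
    fun i j k h => congrFun hw ⟨(i, j, k), m.mem_grid.2 h⟩
  have hS : IsFDSolution m K σ f fext u₁ g (m.extend w) := by
    rw [isFDSolution_iff]
    refine ⟨fun i j k hi hi' hj hj' hk hk' => ?_, fun j k hj hj' hk hk' => ?_,
      fun i j k h => ?_⟩
    · rw [← m.op_of_interior K σ _ hi hi' hj hj' hk hk',
        hU i j k ⟨⟨hi.le, hi'.le⟩, ⟨hj.le, hj'.le⟩, ⟨hk.le, hk'.le⟩⟩,
        if_neg (by unfold Mesh.IsDirichletIndex; lia), if_neg hi.ne']
    · have := m.Nx_pos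
      rw [← m.op_of_robin K σ _ hj hj' hk hk',
        hU 0 j k ⟨⟨le_rfl, by lia⟩, ⟨hj.le, hj'.le⟩, ⟨hk.le, hk'.le⟩⟩,
        if_neg (by unfold Mesh.IsDirichletIndex; lia), if_pos rfl]
    · rw [← m.op_of_dirichlet K σ (m.extend w) h, hU i j k h.1, if_pos h]
  refine ⟨_, hS, fun V hV i j k h => ?_⟩
  rw [isFDSolution_iff] at hS hV
  have := m.stability hK hσ (v := fun a b c => V a b c + -1 * m.extend w a b c) le_rfl
    (fun i j k hd => by rw [hV.2.2 i j k hd, hS.2.2 i j k hd]; ring)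
    (fun i j k hi hi' hj hj' hk hk' => by
      rw [opInt_comb, hV.1 i j k hi hi' hj hj' hk hk', hS.1 i j k hi hi' hj hj' hk hk']; simp)
    (fun j k hj hj' hk hk' => by
      rw [opRobin_comb, hV.2.1 j k hj hj' hk hk', hS.2.1 j k hj hj' hk hk']; simp) h
  rw [zero_mul] at this
  have := abs_nonpos_iff.1 this
  linarith

end RobinHOC

/-! ### Taylor's formula and second differences -/

namespace RobinHOC

/-- On the interval `I`, each `φ (k + 1)` is the derivative of `φ k`, for `k < n`. -/
def DerivChain (I : Set ℝ) (n : ℕ) (φ : ℕ → ℝ → ℝ) : Prop :=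
  ∀ k < n, ∀ x ∈ I, HasDerivWithinAt (φ k) (φ (k + 1) x) I x

theorem DerivChain.tail {I : Set ℝ} {n : ℕ} {φ : ℕ → ℝ → ℝ} (h : DerivChain I (n + 1) φ) :
    DerivChain I n (fun k => φ (k + 1)) :=
  fun k hk x hx => h (k + 1) (by lia) x hx

/-- Differentiation shifts the coefficients, so the remainder of a chain has the remainder of its
tail as derivative. This drives the induction in `DerivChain.taylor`. -/
theorem hasDerivAt_taylorSum (φ : ℕ → ℝ) (n : ℕ) (x₀ x : ℝ) :
    HasDerivAt (fun x => ∑ k ∈ Finset.range (n + 1), φ k * (x - x₀) ^ k / k.factorial)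
      (∑ k ∈ Finset.range n, φ (k + 1) * (x - x₀) ^ k / k.factorial) x := by
  induction n with
  | zero => simpa using hasDerivAt_const x (φ 0)
  | succ n ih =>
    have h1 : HasDerivAt (fun x => φ (n + 1) * (x - x₀) ^ (n + 1) / (n + 1).factorial)
        (φ (n + 1) * (x - x₀) ^ n / n.factorial) x := by
      have h2 := ((((hasDerivAt_id x).sub_const x₀).pow (n + 1)).const_mul (φ (n + 1))).div_const
        ((n + 1).factorial : ℝ)
      refine h2.congr_deriv ?_
      simp only [id, Nat.factorial_succ, Nat.cast_mul, Nat.add_sub_cancel]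
      field_simp
    have h3 := ih.add h1
    rw [Finset.sum_range_succ (n := n)]
    refine h3.congr_of_eventuallyEq (Filter.Eventually.of_forall fun y => ?_)
    exact Finset.sum_range_succ _ (n + 1)

/-- Taylor's formula with a bound for the remainder, on both sides of the base point. -/
theorem DerivChain.taylor {I : Set ℝ} (hI : Convex ℝ I) {M : ℝ} {x₀ : ℝ} (hx₀ : x₀ ∈ I) (n : ℕ) :
    ∀ {φ : ℕ → ℝ → ℝ}, DerivChain I n φ → (∀ x ∈ I, |φ n x| ≤ M) → ∀ x ∈ I,
      |φ 0 x - ∑ k ∈ Finset.range n, φ k x₀ * (x - x₀) ^ k / k.factorial| ≤ M * |x - x₀| ^ n := by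
  induction n with
  | zero => intro φ _ hM x hx; simpa using hM x hx
  | succ n ih =>
    intro φ hφ hM x hx
    have hsub : uIcc x₀ x ⊆ I := by
      rw [← segment_eq_uIcc]; exact hI.segment_subset hx₀ hx
    have hM0 : 0 ≤ M := (abs_nonneg _).trans (hM x hx)
    -- Mean value inequality with the derivative bounded uniformly on the segment; this gives up the
    -- factor `1/n!`, which does not affect the order.
    have key := (convex_uIcc x₀ x).norm_image_sub_le_of_norm_hasDerivWithin_le
      (f := fun x => φ 0 x - ∑ k ∈ Finset.range (n + 1), φ k x₀ * (x - x₀) ^ k / k.factorial)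
      (C := M * |x - x₀| ^ n)
      (fun y hy => ((hφ 0 (Nat.succ_pos n) y (hsub hy)).mono hsub).sub
        (hasDerivAt_taylorSum (fun k => φ k x₀) n x₀ y).hasDerivWithinAt)
      (fun y hy => by
        refine (ih hφ.tail hM y (hsub hy)).trans ?_
        exact mul_le_mul_of_nonneg_left
          (pow_le_pow_left₀ (abs_nonneg _) (abs_sub_left_of_mem_uIcc hy) n) hM0)
      left_mem_uIcc right_mem_uIcc
    have h0 : φ 0 x₀ - ∑ k ∈ Finset.range (n + 1), φ k x₀ * (x₀ - x₀) ^ k / k.factorial = 0 := by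
      rw [Finset.sum_range_succ']
      simp
    simp only [h0, sub_zero, Real.norm_eq_abs] at key
    rw [pow_succ, ← mul_assoc]
    exact key

/-- The undivided second difference. -/
def dd (h : ℝ) (f : ℝ → ℝ) (x : ℝ) : ℝ := f (x + h) - 2 * f x + f (x - h)

section SecondDifferences

variable {I J : Set ℝ} {h M : ℝ}

theorem DerivChain.taylor_add_sub (hI : Convex ℝ I) (hh : 0 < h) {x : ℝ} (hx : x ∈ I)
    (hx₁ : x + h ∈ I) (hx₂ : x - h ∈ I) {n : ℕ} {φ : ℕ → ℝ → ℝ} (hφ : DerivChain I n φ)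
    (hM : ∀ y ∈ I, |φ n y| ≤ M) :
    |φ 0 (x + h) - ∑ k ∈ Finset.range n, φ k x * h ^ k / k.factorial| ≤ M * h ^ n ∧
    |φ 0 (x - h) - ∑ k ∈ Finset.range n, φ k x * (-h) ^ k / k.factorial| ≤ M * h ^ n := by
  have h1 := hφ.taylor hI hx n hM _ hx₁
  have h2 := hφ.taylor hI hx n hM _ hx₂
  rw [add_sub_cancel_left, abs_of_pos hh] at h1
  rw [sub_sub_cancel_left, abs_neg, abs_of_pos hh] at h2
  exact ⟨h1, h2⟩

theorem DerivChain.abs_dd_le (hI : Convex ℝ I) (hh : 0 < h) {x : ℝ} (hx : x ∈ I)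
    (hx₁ : x + h ∈ I) (hx₂ : x - h ∈ I) {φ : ℕ → ℝ → ℝ} (hφ : DerivChain I 2 φ)
    (hM : ∀ y ∈ I, |φ 2 y| ≤ M) : |dd h (φ 0) x| ≤ 2 * M * h ^ 2 := by
  obtain ⟨h1, h2⟩ := hφ.taylor_add_sub hI hh hx hx₁ hx₂ hM
  simp only [Finset.sum_range_succ, Finset.sum_range_zero, Nat.factorial] at h1 h2
  norm_num at h1 h2
  rw [abs_le] at h1 h2 ⊢
  unfold dd
  constructor <;> linarith

/-- Odd Taylor terms cancel. The exponent `3` serves the boundary estimate, which uses derivatives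
of total order at most five. -/
theorem DerivChain.abs_dd_sub_le (hI : Convex ℝ I) (hh : 0 < h) {x : ℝ} (hx : x ∈ I)
    (hx₁ : x + h ∈ I) (hx₂ : x - h ∈ I) {n : ℕ} (hn : n = 3 ∨ n = 4) {φ : ℕ → ℝ → ℝ}
    (hφ : DerivChain I n φ) (hM : ∀ y ∈ I, |φ n y| ≤ M) :
    |dd h (φ 0) x - h ^ 2 * φ 2 x| ≤ 2 * M * h ^ n := by
  obtain ⟨h1, h2⟩ := hφ.taylor_add_sub hI hh hx hx₁ hx₂ hM
  rcases hn with rfl | rfl <;>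
  · simp only [Finset.sum_range_succ, Finset.sum_range_zero, Nat.factorial] at h1 h2
    push_cast at h1 h2
    rw [abs_le] at h1 h2 ⊢
    unfold dd
    constructor <;> linarith

/-- Taylor gives `h² φ₂ + (h⁴/12) φ₄` with error `2 M hⁿ`; trading `h² φ₄` for the second difference
of `φ₂` adds `2/12`, whence `13/6`. -/
theorem DerivChain.abs_dd_sub_compact_le (hI : Convex ℝ I) (hh : 0 < h) {x : ℝ} (hx : x ∈ I)
    (hx₁ : x + h ∈ I) (hx₂ : x - h ∈ I) {n : ℕ} (hn : n = 5 ∨ n = 6) {φ : ℕ → ℝ → ℝ}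
    (hφ : DerivChain I n φ) (hM : ∀ y ∈ I, |φ n y| ≤ M) :
    |dd h (φ 0) x - h ^ 2 * φ 2 x - h ^ 2 / 12 * dd h (φ 2) x| ≤ 13 / 6 * M * h ^ n := by
  obtain ⟨h1, h2⟩ := hφ.taylor_add_sub hI hh hx hx₁ hx₂ hM
  have h3 : |dd h (φ 2) x - h ^ 2 * φ 4 x| ≤ 2 * M * h ^ (n - 2) := by
    refine DerivChain.abs_dd_sub_le (φ := fun k => φ (k + 2)) hI hh hx hx₁ hx₂ (by lia)
      (fun k hk y hy => hφ (k + 2) (by lia) y hy) ?_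
    rwa [show n - 2 + 2 = n by lia]
  have h4 := mul_le_mul_of_nonneg_left h3 (show 0 ≤ h ^ 2 / 12 by positivity)
  rw [← abs_of_nonneg (show 0 ≤ h ^ 2 / 12 by positivity), ← abs_mul,
    abs_of_nonneg (show 0 ≤ h ^ 2 / 12 by positivity)] at h4
  rcases hn with rfl | rfl <;>
  · simp only [Finset.sum_range_succ, Finset.sum_range_zero, Nat.factorial] at h1 h2 h4
    push_cast at h1 h2
    rw [abs_le] at h1 h2 h4 ⊢
    unfold dd at h4 ⊢
    constructor <;> linarith

/-- A family of mixed partial derivatives up to order `n` on the rectangle `I × J`. -/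
def DerivGrid (I J : Set ℝ) (n : ℕ) (φ : ℕ → ℕ → ℝ → ℝ → ℝ) : Prop :=
  (∀ k l, k + l < n → ∀ s ∈ I, ∀ t ∈ J,
    HasDerivWithinAt (fun s => φ k l s t) (φ (k + 1) l s t) I s) ∧
  (∀ k l, k + l < n → ∀ s ∈ I, ∀ t ∈ J,
    HasDerivWithinAt (fun t => φ k l s t) (φ k (l + 1) s t) J t)

theorem DerivGrid.chain_left {n : ℕ} {φ : ℕ → ℕ → ℝ → ℝ → ℝ} (hφ : DerivGrid I J n φ) {l p : ℕ}
    (hl : l + p ≤ n) {t : ℝ} (ht : t ∈ J) : DerivChain I p (fun k s => φ k l s t) :=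
  fun k hk s hs => hφ.1 k l (by lia) s hs t ht

theorem DerivGrid.chain_right {n : ℕ} {φ : ℕ → ℕ → ℝ → ℝ → ℝ} (hφ : DerivGrid I J n φ) {k p : ℕ}
    (hk : k + p ≤ n) {s : ℝ} (hs : s ∈ I) : DerivChain J p (fun l t => φ k l s t) :=
  fun l hl t ht => hφ.2 k l (by lia) s hs t ht

/-- The error of the `t`-difference is a function of `s` whose second derivative is the same error
for `φ 2 ·`, hence at most `2 M h^(n-2)`; differencing in `s` contributes `2 h²`. -/
theorem DerivGrid.abs_dd_dd_sub_le (hI : Convex ℝ I) (hJ : Convex ℝ J) (hh : 0 < h) {s t : ℝ}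
    (hs : s ∈ I) (hs₁ : s + h ∈ I) (hs₂ : s - h ∈ I) (ht : t ∈ J) (ht₁ : t + h ∈ J)
    (ht₂ : t - h ∈ J) {n : ℕ} (hn : n = 5 ∨ n = 6) {φ : ℕ → ℕ → ℝ → ℝ → ℝ}
    (hφ : DerivGrid I J n φ) (hM : ∀ s ∈ I, ∀ t ∈ J, |φ 2 (n - 2) s t| ≤ M) :
    |dd h (fun s => dd h (φ 0 0 s) t) s - h ^ 2 * dd h (fun s => φ 0 2 s t) s|
      ≤ 4 * M * h ^ n := by
  have key := DerivChain.abs_dd_le (φ := fun k s => dd h (φ k 0 s) t - h ^ 2 * φ k 2 s t)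
    (M := 2 * M * h ^ (n - 2)) hI hh hs hs₁ hs₂
    (fun k hk y hy => by
      have d := hφ.1 k 0 (by lia) y hy
      exact (((d _ ht₁).sub ((d _ ht).const_mul 2)).add (d _ ht₂)).sub
        ((hφ.1 k 2 (by lia) y hy t ht).const_mul (h ^ 2)))
    (fun y hy => (hφ.chain_right (k := 2) (p := n - 2) (by lia) hy).abs_dd_sub_le hJ hh ht ht₁
      ht₂ (by lia) (hM y hy))
  have e : dd h (fun s => dd h (φ 0 0 s) t) s - h ^ 2 * dd h (fun s => φ 0 2 s t) s
      = dd h (fun s => dd h (φ 0 0 s) t - h ^ 2 * φ 0 2 s t) s := by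
    unfold dd; ring
  rw [e]
  refine key.trans (le_of_eq ?_)
  rcases hn with rfl | rfl <;> norm_num <;> ring

/-- The quadratic Taylor remainder in `s` has second `t`-derivative at most `M h³`; differencing in
`t` contributes `2 h²`. -/
theorem DerivGrid.abs_dd_taylor_le (hI : Convex ℝ I) (hJ : Convex ℝ J) (hh : 0 < h) {s t : ℝ}
    (hs : s ∈ I) (hs₁ : s + h ∈ I) (ht : t ∈ J) (ht₁ : t + h ∈ J)
    (ht₂ : t - h ∈ J) {φ : ℕ → ℕ → ℝ → ℝ → ℝ}
    (hφ : DerivGrid I J 5 φ) (hM : ∀ s ∈ I, ∀ t ∈ J, |φ 3 2 s t| ≤ M) :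
    |dd h (φ 0 0 (s + h)) t - (dd h (φ 0 0 s) t + h * dd h (φ 1 0 s) t
      + h ^ 2 / 2 * dd h (φ 2 0 s) t)| ≤ 2 * M * h ^ 5 := by
  have key := DerivChain.abs_dd_le
    (φ := fun l t => φ 0 l (s + h) t - (φ 0 l s t + h * φ 1 l s t + h ^ 2 / 2 * φ 2 l s t))
    (M := M * h ^ 3) hJ hh ht ht₁ ht₂
    (fun l hl y hy => (hφ.2 0 l (by lia) _ hs₁ y hy).sub
      (((hφ.2 0 l (by lia) _ hs y hy).add ((hφ.2 1 l (by lia) _ hs y hy).const_mul h)).add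
        ((hφ.2 2 l (by lia) _ hs y hy).const_mul (h ^ 2 / 2))))
    (fun y hy => by
      have := (hφ.chain_left (l := 2) (p := 3) (by lia) hy).taylor hI hs 3
        (fun x hx => hM x hx y hy) _ hs₁
      rw [add_sub_cancel_left, abs_of_pos hh] at this
      simp only [Finset.sum_range_succ, Finset.sum_range_zero, Nat.factorial] at this
      push_cast at this
      refine le_trans (le_of_eq ?_) this
      congr 1; ring)
  have e : dd h (φ 0 0 (s + h)) t - (dd h (φ 0 0 s) t + h * dd h (φ 1 0 s) t
      + h ^ 2 / 2 * dd h (φ 2 0 s) t) = dd h (fun t => φ 0 0 (s + h) t - (φ 0 0 s t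
        + h * φ 1 0 s t + h ^ 2 / 2 * φ 2 0 s t)) t := by
    unfold dd; ring
  rw [e]
  exact key.trans (le_of_eq (by ring))

end SecondDifferences

end RobinHOC

/-! ### Truncation errors of the interior and boundary stencils -/

namespace RobinHOC

variable {B : Box}

/-- `U a b c` are the partial derivatives `∂_x^a ∂_y^b ∂_z^c u` on the closed box, up to
order six. -/
structure Jet (B : Box) (u : ℝ × ℝ × ℝ → ℝ) (U : ℕ → ℕ → ℕ → ℝ → ℝ → ℝ → ℝ) : Prop where
  eq : ∀ x ∈ Icc B.xl B.xr, ∀ y ∈ Icc B.yl B.yr, ∀ z ∈ Icc B.zl B.zr,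
    u (x, y, z) = U 0 0 0 x y z
  cont : ∀ a b c, a + b + c ≤ 6 →
    ContinuousOn (fun p : ℝ × ℝ × ℝ => U a b c p.1 p.2.1 p.2.2) B.closed
  dx : ∀ a b c, a + b + c < 6 → ∀ x ∈ Icc B.xl B.xr, ∀ y ∈ Icc B.yl B.yr, ∀ z ∈ Icc B.zl B.zr,
    HasDerivWithinAt (fun s => U a b c s y z) (U (a + 1) b c x y z) (Icc B.xl B.xr) x
  dy : ∀ a b c, a + b + c < 6 → ∀ x ∈ Icc B.xl B.xr, ∀ y ∈ Icc B.yl B.yr, ∀ z ∈ Icc B.zl B.zr,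
    HasDerivWithinAt (fun s => U a b c x s z) (U a (b + 1) c x y z) (Icc B.yl B.yr) y
  dz : ∀ a b c, a + b + c < 6 → ∀ x ∈ Icc B.xl B.xr, ∀ y ∈ Icc B.yl B.yr, ∀ z ∈ Icc B.zl B.zr,
    HasDerivWithinAt (fun s => U a b c x y s) (U a b (c + 1) x y z) (Icc B.zl B.zr) z

/-- All partial derivatives of order `n` are bounded by `M`. -/
def JetBound (B : Box) (U : ℕ → ℕ → ℕ → ℝ → ℝ → ℝ → ℝ) (n : ℕ) (M : ℝ) : Prop :=
  ∀ a b c, a + b + c = n → ∀ x ∈ Icc B.xl B.xr, ∀ y ∈ Icc B.yl B.yr, ∀ z ∈ Icc B.zl B.zr,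
    |U a b c x y z| ≤ M

/-- The Laplacian of the jet. -/
def jetLap (U : ℕ → ℕ → ℕ → ℝ → ℝ → ℝ → ℝ) (x y z : ℝ) : ℝ :=
  U 2 0 0 x y z + U 0 2 0 x y z + U 0 0 2 x y z

namespace Mesh

variable (m : Mesh B)

theorem x_add_one (i : ℤ) : m.x (i + 1) = m.x i + m.h := by simp only [x]; push_cast; ring
theorem x_sub_one (i : ℤ) : m.x (i - 1) = m.x i - m.h := by simp only [x]; push_cast; ring
theorem y_add_one (i : ℤ) : m.y (i + 1) = m.y i + m.h := by simp only [y]; push_cast; ring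
theorem y_sub_one (i : ℤ) : m.y (i - 1) = m.y i - m.h := by simp only [y]; push_cast; ring
theorem z_add_one (i : ℤ) : m.z (i + 1) = m.z i + m.h := by simp only [z]; push_cast; ring
theorem z_sub_one (i : ℤ) : m.z (i - 1) = m.z i - m.h := by simp only [z]; push_cast; ring
theorem x_zero : m.x 0 = B.xl := by simp [x]
theorem x_one : m.x 1 = B.xl + m.h := by simp [x]

theorem coord_mem {a b h : ℝ} {N : ℕ} (hh : 0 < h) (hN : a + N * h = b) {i : ℤ} (hi : 0 ≤ i)
    (hi' : i ≤ N) : a + i * h ∈ Icc a b := by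
  have h1 : (0 : ℝ) ≤ i := by exact_mod_cast hi
  have h2 : (i : ℝ) ≤ N := by exact_mod_cast hi'
  rw [← hN]
  exact ⟨by nlinarith, by nlinarith⟩

theorem coord_mem_Ioo {a b h : ℝ} {N : ℕ} (hh : 0 < h) (hN : a + N * h = b) {i : ℤ} (hi : 0 < i)
    (hi' : i < N) : a + i * h ∈ Ioo a b := by
  have h1 : (0 : ℝ) < i := by exact_mod_cast hi
  have h2 : (i : ℝ) < N := by exact_mod_cast hi'
  rw [← hN]
  exact ⟨by nlinarith, by nlinarith⟩

theorem x_mem {i : ℤ} (hi : 0 ≤ i) (hi' : i ≤ m.Nx) : m.x i ∈ Icc B.xl B.xr :=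
  coord_mem m.h_pos m.hNx hi hi'
theorem y_mem {i : ℤ} (hi : 0 ≤ i) (hi' : i ≤ m.Ny) : m.y i ∈ Icc B.yl B.yr :=
  coord_mem m.h_pos m.hNy hi hi'
theorem z_mem {i : ℤ} (hi : 0 ≤ i) (hi' : i ≤ m.Nz) : m.z i ∈ Icc B.zl B.zr :=
  coord_mem m.h_pos m.hNz hi hi'

end Mesh

section Consistency

variable {u : ℝ × ℝ × ℝ → ℝ} {U : ℕ → ℕ → ℕ → ℝ → ℝ → ℝ → ℝ}

theorem Jet.chain_x (J : Jet B u U) {a b c n : ℕ} (hn : a + b + c + n ≤ 6) {y z : ℝ}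
    (hy : y ∈ Icc B.yl B.yr) (hz : z ∈ Icc B.zl B.zr) :
    DerivChain (Icc B.xl B.xr) n (fun k s => U (a + k) b c s y z) :=
  fun k hk x hx => J.dx (a + k) b c (by lia) x hx y hy z hz

theorem Jet.chain_y (J : Jet B u U) {a b c n : ℕ} (hn : a + b + c + n ≤ 6) {x z : ℝ}
    (hx : x ∈ Icc B.xl B.xr) (hz : z ∈ Icc B.zl B.zr) :
    DerivChain (Icc B.yl B.yr) n (fun k s => U a (b + k) c x s z) :=
  fun k hk y hy => J.dy a (b + k) c (by lia) x hx y hy z hz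

theorem Jet.chain_z (J : Jet B u U) {a b c n : ℕ} (hn : a + b + c + n ≤ 6) {x y : ℝ}
    (hx : x ∈ Icc B.xl B.xr) (hy : y ∈ Icc B.yl B.yr) :
    DerivChain (Icc B.zl B.zr) n (fun k s => U a b (c + k) x y s) :=
  fun k hk z hz => J.dz a b (c + k) (by lia) x hx y hy z hz

/-- Each pair of axes is needed in both orders, because `DerivGrid.abs_dd_dd_sub_le` is not
symmetric in its two variables. -/
theorem Jet.grid_xy (J : Jet B u U) {n : ℕ} (hn : n ≤ 6) {z : ℝ} (hz : z ∈ Icc B.zl B.zr) :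
    DerivGrid (Icc B.xl B.xr) (Icc B.yl B.yr) n (fun k l s t => U k l 0 s t z) :=
  ⟨fun k l _ s hs t ht => J.dx k l 0 (by lia) s hs t ht z hz,
    fun k l _ s hs t ht => J.dy k l 0 (by lia) s hs t ht z hz⟩

theorem Jet.grid_yx (J : Jet B u U) {n : ℕ} (hn : n ≤ 6) {z : ℝ} (hz : z ∈ Icc B.zl B.zr) :
    DerivGrid (Icc B.yl B.yr) (Icc B.xl B.xr) n (fun k l t s => U l k 0 s t z) :=
  ⟨fun k l _ t ht s hs => J.dy l k 0 (by lia) s hs t ht z hz,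
    fun k l _ t ht s hs => J.dx l k 0 (by lia) s hs t ht z hz⟩

theorem Jet.grid_xz (J : Jet B u U) {n : ℕ} (hn : n ≤ 6) {y : ℝ} (hy : y ∈ Icc B.yl B.yr) :
    DerivGrid (Icc B.xl B.xr) (Icc B.zl B.zr) n (fun k l s t => U k 0 l s y t) :=
  ⟨fun k l _ s hs t ht => J.dx k 0 l (by lia) s hs y hy t ht,
    fun k l _ s hs t ht => J.dz k 0 l (by lia) s hs y hy t ht⟩

theorem Jet.grid_zx (J : Jet B u U) {n : ℕ} (hn : n ≤ 6) {y : ℝ} (hy : y ∈ Icc B.yl B.yr) :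
    DerivGrid (Icc B.zl B.zr) (Icc B.xl B.xr) n (fun k l t s => U l 0 k s y t) :=
  ⟨fun k l _ t ht s hs => J.dz l 0 k (by lia) s hs y hy t ht,
    fun k l _ t ht s hs => J.dx l 0 k (by lia) s hs y hy t ht⟩

theorem Jet.grid_yz (J : Jet B u U) {n : ℕ} (hn : n ≤ 6) {x : ℝ} (hx : x ∈ Icc B.xl B.xr) :
    DerivGrid (Icc B.yl B.yr) (Icc B.zl B.zr) n (fun k l s t => U 0 k l x s t) :=
  ⟨fun k l _ s hs t ht => J.dy 0 k l (by lia) x hx s hs t ht,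
    fun k l _ s hs t ht => J.dz 0 k l (by lia) x hx s hs t ht⟩

theorem Jet.grid_zy (J : Jet B u U) {n : ℕ} (hn : n ≤ 6) {x : ℝ} (hx : x ∈ Icc B.xl B.xr) :
    DerivGrid (Icc B.zl B.zr) (Icc B.yl B.yr) n (fun k l t s => U 0 l k x s t) :=
  ⟨fun k l _ t ht s hs => J.dz 0 l k (by lia) x hx s hs t ht,
    fun k l _ t ht s hs => J.dy 0 l k (by lia) x hx s hs t ht⟩

/-- With `δ_a` the second difference along axis `a`, `h² lap19 = Σ δ_a + (1/6) Σ_{a<b} δ_a δ_b` and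
`avg7 = 1 + (1/12) Σ δ_a`. Pure terms leave compact remainders; each `δ_a δ_b` is split evenly
between its two orders to match `δ_a u_bb` and `δ_b u_aa`. -/
theorem Jet.abs_lap19_sub_le (J : Jet B u U) {M : ℝ} (hM : JetBound B U 6 M) (m : Mesh B)
    {i j k : ℤ} (hi : 0 < i) (hi' : i < m.Nx) (hj : 0 < j) (hj' : j < m.Ny) (hk : 0 < k)
    (hk' : k < m.Nz) :
    |lap19 m.h (fun i j k => U 0 0 0 (m.x i) (m.y j) (m.z k)) i j k
      - avg7 (fun i j k => jetLap U (m.x i) (m.y j) (m.z k)) i j k| ≤ 9 * M * m.h ^ 4 := by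
  have hh := m.h_pos
  have X0 := m.x_mem hi.le hi'.le
  have X1 := m.x_mem (i := i + 1) (by lia) (by lia)
  have X2 := m.x_mem (i := i - 1) (by lia) (by lia)
  have Y0 := m.y_mem hj.le hj'.le
  have Y1 := m.y_mem (i := j + 1) (by lia) (by lia)
  have Y2 := m.y_mem (i := j - 1) (by lia) (by lia)
  have Z0 := m.z_mem hk.le hk'.le
  have Z1 := m.z_mem (i := k + 1) (by lia) (by lia)
  have Z2 := m.z_mem (i := k - 1) (by lia) (by lia)
  simp only [lap19, avg7, m.x_add_one, m.x_sub_one, m.y_add_one, m.y_sub_one, m.z_add_one,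
    m.z_sub_one] at X1 X2 Y1 Y2 Z1 Z2 ⊢
  generalize m.x i = x at *
  generalize m.y j = y at *
  generalize m.z k = z at *
  generalize m.h = h at *
  have hM0 : 0 ≤ M := (abs_nonneg _).trans (hM 6 0 0 rfl x X0 y Y0 z Z0)
  have cx := convex_Icc (𝕜 := ℝ) B.xl B.xr
  have cy := convex_Icc (𝕜 := ℝ) B.yl B.yr
  have cz := convex_Icc (𝕜 := ℝ) B.zl B.zr
  have r1 := (J.chain_x (a := 0) (b := 0) (c := 0) (n := 6) le_rfl Y0 Z0).abs_dd_sub_compact_le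
    cx hh X0 X1 X2 (Or.inr rfl) (fun s hs => hM _ 0 0 rfl s hs y Y0 z Z0)
  have r2 := (J.chain_y (a := 0) (b := 0) (c := 0) (n := 6) le_rfl X0 Z0).abs_dd_sub_compact_le
    cy hh Y0 Y1 Y2 (Or.inr rfl) (fun s hs => hM 0 _ 0 rfl x X0 s hs z Z0)
  have r3 := (J.chain_z (a := 0) (b := 0) (c := 0) (n := 6) le_rfl X0 Y0).abs_dd_sub_compact_le
    cz hh Z0 Z1 Z2 (Or.inr rfl) (fun s hs => hM 0 0 _ rfl x X0 y Y0 s hs)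
  have q1 := (J.grid_xy le_rfl Z0).abs_dd_dd_sub_le cx cy hh X0 X1 X2 Y0 Y1 Y2 (Or.inr rfl)
    (fun s hs t ht => hM 2 4 0 rfl s hs t ht z Z0)
  have q2 := (J.grid_yx le_rfl Z0).abs_dd_dd_sub_le cy cx hh Y0 Y1 Y2 X0 X1 X2 (Or.inr rfl)
    (fun s hs t ht => hM 4 2 0 rfl t ht s hs z Z0)
  have q3 := (J.grid_xz le_rfl Y0).abs_dd_dd_sub_le cx cz hh X0 X1 X2 Z0 Z1 Z2 (Or.inr rfl)
    (fun s hs t ht => hM 2 0 4 rfl s hs y Y0 t ht)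
  have q4 := (J.grid_zx le_rfl Y0).abs_dd_dd_sub_le cz cx hh Z0 Z1 Z2 X0 X1 X2 (Or.inr rfl)
    (fun s hs t ht => hM 4 0 2 rfl t ht y Y0 s hs)
  have q5 := (J.grid_yz le_rfl X0).abs_dd_dd_sub_le cy cz hh Y0 Y1 Y2 Z0 Z1 Z2 (Or.inr rfl)
    (fun s hs t ht => hM 0 2 4 rfl x X0 s hs t ht)
  have q6 := (J.grid_zy le_rfl X0).abs_dd_dd_sub_le cz cy hh Z0 Z1 Z2 Y0 Y1 Y2 (Or.inr rfl)
    (fun s hs t ht => hM 0 4 2 rfl x X0 t ht s hs)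
  simp only [zero_add] at r1 r2 r3
  -- The total is `3 · 13/6 + 6 · 4/12 = 17/2 ≤ 9`.
  have key : ∀ T r1 r2 r3 q1 q2 q3 q4 q5 q6 : ℝ,
      h ^ 2 * T = r1 + r2 + r3 + 1 / 12 * (q1 + q2 + q3 + q4 + q5 + q6) →
      |r1| ≤ 13 / 6 * M * h ^ 6 → |r2| ≤ 13 / 6 * M * h ^ 6 → |r3| ≤ 13 / 6 * M * h ^ 6 →
      |q1| ≤ 4 * M * h ^ 6 → |q2| ≤ 4 * M * h ^ 6 → |q3| ≤ 4 * M * h ^ 6 →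
      |q4| ≤ 4 * M * h ^ 6 → |q5| ≤ 4 * M * h ^ 6 → |q6| ≤ 4 * M * h ^ 6 →
      |T| ≤ 9 * M * h ^ 4 := by
    intro T r1 r2 r3 q1 q2 q3 q4 q5 q6 hT a1 a2 a3 b1 b2 b3 b4 b5 b6
    rw [abs_le] at a1 a2 a3 b1 b2 b3 b4 b5 b6
    have h6 : 0 ≤ M * h ^ 6 := by positivity
    have hp : 0 < h ^ 2 := by positivity
    rw [← mul_le_mul_iff_right₀ hp, ← abs_of_pos hp, ← abs_mul, abs_of_pos hp, hT, abs_le]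
    constructor <;> linarith
  refine key _ _ _ _ _ _ _ _ _ _ ?_ r1 r2 r3 q1 q2 q3 q4 q5 q6
  simp only [dd, jetLap]
  field_simp
  ring

/-- Expanding layer `x_1` about the face leaves tangential differences of `u`, `u_x`, `u_xx` and the
pure terms `(h/3) u_xxx + (h²/12) u_xxxx`. The weights `-1` and `3` in the source average are tuned
to these: `(-F + 3 F₁)/12` contains `h/3` and `h²/12` times the first and second `x`-derivatives of
the Laplacian. -/
theorem Jet.abs_robinLap_sub_le (J : Jet B u U) {M : ℝ} (hM : JetBound B U 5 M) (m : Mesh B)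
    {σ δ F : ℝ} {j k : ℤ} (hj : 0 < j) (hj' : j < m.Ny) (hk : 0 < k) (hk' : k < m.Nz)
    (hF : |F - (jetLap U B.xl (m.y j) (m.z k)
      - m.h * jetLap (fun a => U (a + 1)) B.xl (m.y j) (m.z k)
      + m.h ^ 2 / 2 * jetLap (fun a => U (a + 2)) B.xl (m.y j) (m.z k))| ≤ δ * m.h ^ 3) :
    |robinLap m.h σ (fun i j k => U 0 0 0 (m.x i) (m.y j) (m.z k)) j k
      - 1 / 12 * (6 * jetLap U (m.x 0) (m.y j) (m.z k) + jetLap U (m.x 0) (m.y (j + 1)) (m.z k)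
        + jetLap U (m.x 0) (m.y (j - 1)) (m.z k) + jetLap U (m.x 0) (m.y j) (m.z (k + 1))
        + jetLap U (m.x 0) (m.y j) (m.z (k - 1)) - F + 3 * jetLap U (m.x 1) (m.y j) (m.z k))
      + 2 / m.h * (-U 1 0 0 B.xl (m.y j) (m.z k) + σ * U 0 0 0 B.xl (m.y j) (m.z k))|
      ≤ (11 * M + δ) * m.h ^ 3 := by
  have hh := m.h_pos
  have X0 := m.x_mem le_rfl (by lia)
  have X1 := m.x_mem (i := 1) (by lia) (by have := m.Nx_pos; lia)
  have Y0 := m.y_mem hj.le hj'.le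
  have Y1 := m.y_mem (i := j + 1) (by lia) (by lia)
  have Y2 := m.y_mem (i := j - 1) (by lia) (by lia)
  have Z0 := m.z_mem hk.le hk'.le
  have Z1 := m.z_mem (i := k + 1) (by lia) (by lia)
  have Z2 := m.z_mem (i := k - 1) (by lia) (by lia)
  simp only [robinLap, m.x_one, m.x_zero, m.y_add_one, m.y_sub_one, m.z_add_one,
    m.z_sub_one] at X0 X1 Y1 Y2 Z1 Z2 hF ⊢
  generalize m.y j = y at *
  generalize m.z k = z at *
  generalize m.h = h at *
  have hM0 : 0 ≤ M := (abs_nonneg _).trans (hM 5 0 0 rfl _ X0 y Y0 z Z0)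
  have cx := convex_Icc (𝕜 := ℝ) B.xl B.xr
  have cy := convex_Icc (𝕜 := ℝ) B.yl B.yr
  have cz := convex_Icc (𝕜 := ℝ) B.zl B.zr
  have p := (J.chain_x (a := 0) (b := 0) (c := 0) (n := 5) (by lia) Y0 Z0).taylor cx X0 5
    (fun s hs => hM _ 0 0 rfl s hs y Y0 z Z0) _ X1
  have p1 := (J.chain_x (a := 2) (b := 0) (c := 0) (n := 3) (by lia) Y0 Z0).taylor cx X0 3
    (fun s hs => hM _ 0 0 rfl s hs y Y0 z Z0) _ X1
  have p2 := (J.chain_x (a := 0) (b := 2) (c := 0) (n := 3) (by lia) Y0 Z0).taylor cx X0 3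
    (fun s hs => hM _ 2 0 rfl s hs y Y0 z Z0) _ X1
  have p3 := (J.chain_x (a := 0) (b := 0) (c := 2) (n := 3) (by lia) Y0 Z0).taylor cx X0 3
    (fun s hs => hM _ 0 2 rfl s hs y Y0 z Z0) _ X1
  have a1 := (J.grid_xy (n := 5) (by lia) Z0).abs_dd_taylor_le cx cy hh X0 X1 Y0 Y1 Y2
    (fun s hs t ht => hM 3 2 0 rfl s hs t ht z Z0)
  have a2 := (J.grid_xz (n := 5) (by lia) Y0).abs_dd_taylor_le cx cz hh X0 X1 Z0 Z1 Z2
    (fun s hs t ht => hM 3 0 2 rfl s hs y Y0 t ht)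
  have b1 := (J.chain_y (a := 0) (b := 0) (c := 0) (n := 5) (by lia)
    X0 Z0).abs_dd_sub_compact_le cy hh Y0 Y1 Y2 (Or.inl rfl)
    (fun s hs => hM 0 _ 0 rfl _ X0 s hs z Z0)
  have b2 := (J.chain_z (a := 0) (b := 0) (c := 0) (n := 5) (by lia)
    X0 Y0).abs_dd_sub_compact_le cz hh Z0 Z1 Z2 (Or.inl rfl)
    (fun s hs => hM 0 0 _ rfl _ X0 y Y0 s hs)
  have c1 := (J.chain_y (a := 1) (b := 0) (c := 0) (n := 4) (by lia)
    X0 Z0).abs_dd_sub_le cy hh Y0 Y1 Y2 (Or.inr rfl)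
    (fun s hs => hM 1 _ 0 rfl _ X0 s hs z Z0)
  have c2 := (J.chain_z (a := 1) (b := 0) (c := 0) (n := 4) (by lia)
    X0 Y0).abs_dd_sub_le cz hh Z0 Z1 Z2 (Or.inr rfl)
    (fun s hs => hM 1 0 _ rfl _ X0 y Y0 s hs)
  have d1 := (J.chain_y (a := 2) (b := 0) (c := 0) (n := 3) (by lia)
    X0 Z0).abs_dd_sub_le cy hh Y0 Y1 Y2 (Or.inl rfl)
    (fun s hs => hM 2 _ 0 rfl _ X0 s hs z Z0)
  have d2 := (J.chain_z (a := 2) (b := 0) (c := 0) (n := 3) (by lia)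
    X0 Y0).abs_dd_sub_le cz hh Z0 Z1 Z2 (Or.inl rfl)
    (fun s hs => hM 2 0 _ rfl _ X0 y Y0 s hs)
  have e1 := (J.grid_yz (n := 5) (by lia) X0).abs_dd_dd_sub_le cy cz hh Y0 Y1 Y2 Z0 Z1 Z2
    (Or.inl rfl) (fun s hs t ht => hM 0 2 3 rfl _ X0 s hs t ht)
  have e2 := (J.grid_zy (n := 5) (by lia) X0).abs_dd_dd_sub_le cz cy hh Z0 Z1 Z2 Y0 Y1 Y2
    (Or.inl rfl) (fun s hs t ht => hM 0 3 2 rfl _ X0 t ht s hs)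
  simp only [zero_add, Nat.reduceAdd, add_sub_cancel_left, abs_of_pos hh,
    Finset.sum_range_succ, Finset.sum_range_zero, Nat.factorial] at p p1 p2 p3 a1 a2 b1 b2 c1 c2 d1 d2
  -- The coefficients of `M` add up to `43/4 ≤ 11`, and `δ` appears with factor `1/12`.
  have key : ∀ T p p1 p2 p3 a1 a2 b1 b2 c1 c2 d1 d2 e1 e2 f : ℝ,
      h ^ 2 * T = 2 * p + 1 / 3 * (a1 + a2) + (b1 + b2) + h / 3 * (c1 + c2)
        + h ^ 2 / 12 * (d1 + d2) + 1 / 12 * (e1 + e2) + h ^ 2 / 12 * f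
        - h ^ 2 / 4 * (p1 + p2 + p3) →
      |p| ≤ M * h ^ 5 → |p1| ≤ M * h ^ 3 → |p2| ≤ M * h ^ 3 → |p3| ≤ M * h ^ 3 →
      |a1| ≤ 2 * M * h ^ 5 → |a2| ≤ 2 * M * h ^ 5 →
      |b1| ≤ 13 / 6 * M * h ^ 5 → |b2| ≤ 13 / 6 * M * h ^ 5 →
      |c1| ≤ 2 * M * h ^ 4 → |c2| ≤ 2 * M * h ^ 4 →
      |d1| ≤ 2 * M * h ^ 3 → |d2| ≤ 2 * M * h ^ 3 →
      |e1| ≤ 4 * M * h ^ 5 → |e2| ≤ 4 * M * h ^ 5 → |f| ≤ δ * h ^ 3 →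
      |T| ≤ (11 * M + δ) * h ^ 3 := by
    intro T p p1 p2 p3 a1 a2 b1 b2 c1 c2 d1 d2 e1 e2 f hT ip ip1 ip2 ip3 ia1 ia2 ib1 ib2 ic1 ic2
      id1 id2 ie1 ie2 if1
    have hp : 0 < h ^ 2 := by positivity
    have scale : ∀ {w a b : ℝ}, 0 ≤ w → |a| ≤ b → |w * a| ≤ w * b := fun hw hab => by
      rw [abs_mul, abs_of_nonneg hw]; exact mul_le_mul_of_nonneg_left hab hw
    have jp1 := scale hp.le ip1
    have jp2 := scale hp.le ip2
    have jp3 := scale hp.le ip3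
    have jc1 := scale hh.le ic1
    have jc2 := scale hh.le ic2
    have jd1 := scale hp.le id1
    have jd2 := scale hp.le id2
    have jf := scale hp.le if1
    have h5 : 0 ≤ M * h ^ 5 := by positivity
    have h6 : 0 ≤ h ^ 2 * (δ * h ^ 3) := (abs_nonneg _).trans jf
    rw [abs_le] at ip ia1 ia2 ib1 ib2 ie1 ie2 jp1 jp2 jp3 jc1 jc2 jd1 jd2 jf
    rw [← mul_le_mul_iff_right₀ hp, ← abs_of_pos hp, ← abs_mul, abs_of_pos hp, hT, abs_le]
    constructor <;> linarith
  refine key _ _ _ _ _ _ _ _ _ _ _ _ _ _ _ _ ?_ p p1 p2 p3 a1 a2 b1 b2 c1 c2 d1 d2 e1 e2 hF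
  simp only [dd, jetLap, zero_add, Nat.reduceAdd]
  push_cast
  field_simp
  ring

end Consistency

end RobinHOC

/-! ### From the boundary value problem to the error bound -/

namespace RobinHOC

variable {B : Box}

section Slices

variable {a b : ℝ} {v : ℝ → ℝ} {φ : ℕ → ℝ → ℝ}

theorem DerivChain.iteratedDeriv_two (hφ : DerivChain (Icc a b) 2 φ)
    (hv : ∀ x ∈ Icc a b, v x = φ 0 x) {x : ℝ} (hx : x ∈ Ioo a b) :
    iteratedDeriv 2 v x = φ 2 x := by
  have h1 : ∀ y ∈ Ioo a b, HasDerivAt v (φ 1 y) y := fun y hy => by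
    have hn : Icc a b ∈ nhds y := Icc_mem_nhds hy.1 hy.2
    refine ((hφ 0 (by norm_num) y (Ioo_subset_Icc_self hy)).hasDerivAt hn).congr_of_eventuallyEq ?_
    filter_upwards [hn] with t ht using hv t ht
  have h2 : deriv v =ᶠ[nhds x] φ 1 := by
    filter_upwards [isOpen_Ioo.mem_nhds hx] with y hy using (h1 y hy).deriv
  rw [show (2 : ℕ) = 1 + 1 from rfl, iteratedDeriv_succ, iteratedDeriv_one, h2.deriv_eq]
  exact ((hφ 1 (by norm_num) x (Ioo_subset_Icc_self hx)).hasDerivAt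
    (Icc_mem_nhds hx.1 hx.2)).deriv

theorem DerivChain.derivWithin_eq (hab : a < b) {n : ℕ} (hn : 0 < n)
    (hφ : DerivChain (Icc a b) n φ) (hv : ∀ x ∈ Icc a b, v x = φ 0 x) {x : ℝ}
    (hx : x ∈ Icc a b) : derivWithin v (Icc a b) x = φ 1 x := by
  rw [derivWithin_congr hv (hv x hx)]
  exact (hφ 0 hn x hx).derivWithin (uniqueDiffOn_Icc hab x hx)

theorem DerivChain.iteratedDerivWithin_two (hab : a < b) (hφ : DerivChain (Icc a b) 2 φ)
    (hv : ∀ x ∈ Icc a b, v x = φ 0 x) {x : ℝ} (hx : x ∈ Icc a b) :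
    iteratedDerivWithin 2 v (Icc a b) x = φ 2 x := by
  have h1 : ∀ y ∈ Icc a b, iteratedDerivWithin 1 v (Icc a b) y = φ 1 y := fun y hy => by
    rw [iteratedDerivWithin_one]
    exact hφ.derivWithin_eq hab (by norm_num) hv hy
  rw [show (2 : ℕ) = 1 + 1 from rfl, iteratedDerivWithin_succ, derivWithin_congr h1 (h1 x hx)]
  exact (hφ 1 (by norm_num) x hx).derivWithin (uniqueDiffOn_Icc hab x hx)

end Slices

theorem Box.closed_subset_closure (B : Box) :
    B.closed ⊆ closure (Ioo B.xl B.xr ×ˢ Ioo B.yl B.yr ×ˢ Ioo B.zl B.zr) := by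
  rw [closure_prod_eq, closure_prod_eq, closure_Ioo B.hx.ne, closure_Ioo B.hy.ne,
    closure_Ioo B.hz.ne]
  rfl

section Error

variable {K σ : ℝ} {u f u₁ : ℝ × ℝ × ℝ → ℝ} {g : ℝ → ℝ → ℝ}
  {U : ℕ → ℕ → ℕ → ℝ → ℝ → ℝ → ℝ}

/-- The equation holds only in the open box, whereas the scheme samples `f` on the faces and the
extension uses its one-sided derivatives there. Continuity of both sides and density carry the
identity to the closed box. -/
theorem Jet.source_eq (J : Jet B u U) (S : IsSolution B K σ u f u₁ g) {x y z : ℝ}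
    (hx : x ∈ Icc B.xl B.xr) (hy : y ∈ Icc B.yl B.yr) (hz : z ∈ Icc B.zl B.zr) :
    f (x, y, z) = jetLap U x y z + K * U 0 0 0 x y z := by
  have hcont : ContinuousOn (fun p : ℝ × ℝ × ℝ =>
      jetLap U p.1 p.2.1 p.2.2 + K * U 0 0 0 p.1 p.2.1 p.2.2) B.closed :=
    (((J.cont 2 0 0 (by norm_num)).add (J.cont 0 2 0 (by norm_num))).add
      (J.cont 0 0 2 (by norm_num))).add (continuousOn_const.mul (J.cont 0 0 0 (by norm_num)))
  have hopen : EqOn f (fun p : ℝ × ℝ × ℝ =>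
      jetLap U p.1 p.2.1 p.2.2 + K * U 0 0 0 p.1 p.2.1 p.2.2)
      (Ioo B.xl B.xr ×ˢ Ioo B.yl B.yr ×ˢ Ioo B.zl B.zr) := by
    rintro ⟨x, y, z⟩ ⟨hx, hy, hz⟩
    simp only at hx hy hz ⊢
    have hx' := Ioo_subset_Icc_self hx
    have hy' := Ioo_subset_Icc_self hy
    have hz' := Ioo_subset_Icc_self hz
    rw [← S.pde x hx y hy z hz, J.eq x hx' y hy' z hz', laplacian,
      (J.chain_x (a := 0) (b := 0) (c := 0) (n := 2) (by lia) hy' hz').iteratedDeriv_two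
        (fun s hs => J.eq s hs y hy' z hz') hx,
      (J.chain_y (a := 0) (b := 0) (c := 0) (n := 2) (by lia) hx' hz').iteratedDeriv_two
        (fun s hs => J.eq x hx' s hs z hz') hy,
      (J.chain_z (a := 0) (b := 0) (c := 0) (n := 2) (by lia) hx' hy').iteratedDeriv_two
        (fun s hs => J.eq x hx' y hy' s hs) hz]
    rfl
  exact hopen.of_subset_closure S.source_cont hcont
    (prod_mono Ioo_subset_Icc_self (prod_mono Ioo_subset_Icc_self Ioo_subset_Icc_self))
    B.closed_subset_closure ⟨hx, hy, hz⟩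

/-- The source and its first two `x`-derivatives along a line, in terms of the jet. -/
theorem Jet.source_chain (J : Jet B u U) {y z : ℝ} (hy : y ∈ Icc B.yl B.yr)
    (hz : z ∈ Icc B.zl B.zr) : DerivChain (Icc B.xl B.xr) 2
      (fun n s => jetLap (fun a => U (a + n)) s y z + K * U n 0 0 s y z) := by
  intro k hk x hx
  have h1 := J.dx (2 + k) 0 0 (by lia) x hx y hy z hz
  have h2 := J.dx (0 + k) 2 0 (by lia) x hx y hy z hz
  have h3 := J.dx (0 + k) 0 2 (by lia) x hx y hy z hz
  have h4 := J.dx k 0 0 (by lia) x hx y hy z hz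
  exact ((h1.add h2).add h3).add (h4.const_mul K)

theorem Jet.robin_eq (J : Jet B u U) (S : IsSolution B K σ u f u₁ g) {y z : ℝ}
    (hy : y ∈ Ioo B.yl B.yr) (hz : z ∈ Ioo B.zl B.zr) :
    g y z = -U 1 0 0 B.xl y z + σ * U 0 0 0 B.xl y z := by
  have hx : B.xl ∈ Icc B.xl B.xr := left_mem_Icc.2 B.hx.le
  have hy' := Ioo_subset_Icc_self hy
  have hz' := Ioo_subset_Icc_self hz
  rw [← S.robin y hy z hz, J.eq _ hx y hy' z hz',
    (J.chain_x (a := 0) (b := 0) (c := 0) (n := 1) (by lia) hy' hz').derivWithin_eq B.hx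
      (by norm_num) (fun s hs => J.eq s hs y hy' z hz') hx]

/-- Error bound in terms of bounds for the derivatives of order three, five and six. -/
theorem Jet.error_le (J : Jet B u U) (hK : K ≤ 0) (hσ : 0 ≤ σ) (S : IsSolution B K σ u f u₁ g)
    {M₃ M₅ M₆ c : ℝ} (h₃ : JetBound B U 3 M₃) (h₅ : JetBound B U 5 M₅) (h₆ : JetBound B U 6 M₆)
    (hc : 0 ≤ c) (m : Mesh B) {fext : ℤ → ℤ → ℝ} (hext : IsExtension m f c fext)
    {V : ℤ → ℤ → ℤ → ℝ} (hV : IsFDSolution m K σ f fext u₁ g V) {i j k : ℤ}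
    (hg : m.IsGridIndex i j k) :
    |m.sample u i j k - V i j k| ≤ (9 * M₆ + 11 * M₅ + c + |K| * M₃) * m.h ^ 4 *
      ((B.xr - B.xl) + (B.xr - B.xl) ^ 2 / 2) := by
  have hh := m.h_pos
  have hxl : B.xl ∈ Icc B.xl B.xr := left_mem_Icc.2 B.hx.le
  have hyl : B.yl ∈ Icc B.yl B.yr := left_mem_Icc.2 B.hy.le
  have hzl : B.zl ∈ Icc B.zl B.zr := left_mem_Icc.2 B.hz.le
  have p₃ : 0 ≤ M₃ := (abs_nonneg _).trans (h₃ 3 0 0 rfl _ hxl _ hyl _ hzl)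
  have p₅ : 0 ≤ M₅ := (abs_nonneg _).trans (h₅ 5 0 0 rfl _ hxl _ hyl _ hzl)
  have p₆ : 0 ≤ M₆ := (abs_nonneg _).trans (h₆ 6 0 0 rfl _ hxl _ hyl _ hzl)
  have pK := abs_nonneg K
  rw [isFDSolution_iff] at hV
  obtain ⟨hI, hR, hD⟩ := hV
  have hu : ∀ i j k, m.IsGridIndex i j k →
      m.sample u i j k = U 0 0 0 (m.x i) (m.y j) (m.z k) := fun i j k h =>
    J.eq _ (m.x_mem h.1.1 h.1.2) _ (m.y_mem h.2.1.1 h.2.1.2) _ (m.z_mem h.2.2.1 h.2.2.2)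
  have hf : ∀ i j k, m.IsGridIndex i j k → m.sample f i j k =
      jetLap U (m.x i) (m.y j) (m.z k) + K * U 0 0 0 (m.x i) (m.y j) (m.z k) := fun i j k h =>
    J.source_eq S (m.x_mem h.1.1 h.1.2) (m.y_mem h.2.1.1 h.2.1.2) (m.z_mem h.2.2.1 h.2.2.2)
  have key := m.stability hK hσ
    (v := fun i j k => U 0 0 0 (m.x i) (m.y j) (m.z k) + -1 * V i j k)
    (s := (9 * M₆ + 11 * M₅ + c + |K| * M₃) * m.h ^ 4) (by positivity) ?_ ?_ ?_ hg
  · rw [hu i j k hg, sub_eq_add_neg, ← neg_one_mul]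
    exact key
  · intro i j k hd
    have hdg := hd.1
    rw [← hu i j k hd.1, hD i j k hd]
    have : m.sample u i j k = m.sample u₁ i j k := by
      have e1 : ∀ i : ℤ, i = m.Nx → m.x i = B.xr := by
        rintro _ rfl; simpa [Mesh.x] using m.hNx
      have e2 : ∀ i : ℤ, i = m.Ny → m.y i = B.yr := by
        rintro _ rfl; simpa [Mesh.y] using m.hNy
      have e3 : ∀ i : ℤ, i = m.Nz → m.z i = B.zr := by
        rintro _ rfl; simpa [Mesh.z] using m.hNz
      have e4 : ∀ i : ℤ, i = 0 → m.y i = B.yl := by rintro _ rfl; simp [Mesh.y]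
      have e5 : ∀ i : ℤ, i = 0 → m.z i = B.zl := by rintro _ rfl; simp [Mesh.z]
      refine S.dirichlet _ _ _ ⟨m.x_mem hdg.1.1 hdg.1.2, m.y_mem hdg.2.1.1 hdg.2.1.2,
        m.z_mem hdg.2.2.1 hdg.2.2.2⟩ ?_
      rcases hd.2 with h | h | h | h | h
      · exact Or.inl (e1 _ h)
      · exact Or.inr (Or.inl (e4 _ h))
      · exact Or.inr (Or.inr (Or.inl (e2 _ h)))
      · exact Or.inr (Or.inr (Or.inr (Or.inl (e5 _ h))))
      · exact Or.inr (Or.inr (Or.inr (Or.inr (e3 _ h))))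
    rw [← this]; ring
  · intro i j k hi hi' hj hj' hk hk'
    rw [opInt_comb, hI i j k hi hi' hj hj' hk hk']
    have e : opInt m.h K (fun i j k => U 0 0 0 (m.x i) (m.y j) (m.z k)) i j k
        + -1 * avg7 (m.sample f) i j k
        = lap19 m.h (fun i j k => U 0 0 0 (m.x i) (m.y j) (m.z k)) i j k
          - avg7 (fun i j k => jetLap U (m.x i) (m.y j) (m.z k)) i j k := by
      simp only [opInt, avg7]
      rw [hf i j k (by unfold Mesh.IsGridIndex; lia),
        hf (i + 1) j k (by unfold Mesh.IsGridIndex; lia),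
        hf (i - 1) j k (by unfold Mesh.IsGridIndex; lia),
        hf i (j + 1) k (by unfold Mesh.IsGridIndex; lia),
        hf i (j - 1) k (by unfold Mesh.IsGridIndex; lia),
        hf i j (k + 1) (by unfold Mesh.IsGridIndex; lia),
        hf i j (k - 1) (by unfold Mesh.IsGridIndex; lia)]
      ring
    rw [e]
    refine (J.abs_lap19_sub_le h₆ m hi hi' hj hj' hk hk').trans ?_
    exact mul_le_mul_of_nonneg_right (by nlinarith) (by positivity)
  · intro j k hj hj' hk hk'
    have hy := m.y_mem hj.le hj'.le
    have hz := m.z_mem hk.le hk'.le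
    have hx1 := m.x_mem (i := 1) (by lia) (by have := m.Nx_pos; lia)
    rw [m.x_one] at hx1
    have hgj := J.robin_eq S (Mesh.coord_mem_Ioo m.h_pos m.hNy hj hj')
      (Mesh.coord_mem_Ioo m.h_pos m.hNz hk hk')
    change g (m.y j) (m.z k) = -U 1 0 0 B.xl (m.y j) (m.z k)
      + σ * U 0 0 0 B.xl (m.y j) (m.z k) at hgj
    -- Since `g - σ u = -u_x`, the ghost value of the exact solution is `u(x_1) - 2 h u_x`. It
    -- differs from the quadratic Taylor value at `xl - h` by the cubic remainder at `x_1`, which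
    -- yields `|K| M₃`. Removing `K` times it from the extension of `Δu + K u` leaves an extension
    -- of `Δu`.
    have hF : |(fext j k - K * (U 0 0 0 (m.x 1) (m.y j) (m.z k)
        - 2 * m.h * U 1 0 0 B.xl (m.y j) (m.z k))) - (jetLap U B.xl (m.y j) (m.z k)
        - m.h * jetLap (fun a => U (a + 1)) B.xl (m.y j) (m.z k)
        + m.h ^ 2 / 2 * jetLap (fun a => U (a + 2)) B.xl (m.y j) (m.z k))|
          ≤ (c + |K| * M₃) * m.h ^ 3 := by
      have h1 := hext j k hj hj' hk hk'
      have hs : ∀ s ∈ Icc B.xl B.xr, f (s, m.y j, m.z k)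
          = jetLap U s (m.y j) (m.z k) + K * U 0 0 0 s (m.y j) (m.z k) :=
        fun s hs => J.source_eq S hs hy hz
      rw [(J.source_chain (K := K) hy hz).derivWithin_eq B.hx (by norm_num) hs hxl,
        (J.source_chain (K := K) hy hz).iteratedDerivWithin_two B.hx hs hxl, hs _ hxl] at h1
      have h2 := (J.chain_x (a := 0) (b := 0) (c := 0) (n := 3) (by lia) hy hz).taylor
        (convex_Icc _ _) hxl 3 (fun s hs => h₃ _ 0 0 rfl s hs _ hy _ hz) _ hx1
      simp only [zero_add, add_sub_cancel_left, abs_of_pos hh,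
        Finset.sum_range_succ, Finset.sum_range_zero, Nat.factorial] at h2
      push_cast at h2
      have h3 := mul_le_mul_of_nonneg_left h2 pK
      rw [← abs_mul] at h3
      rw [m.x_one]
      have h4 := (abs_sub _ _).trans (add_le_add h1 h3)
      refine le_trans (le_of_eq ?_) (h4.trans (le_of_eq ?_))
      · congr 1; ring
      · ring
    have h1 := J.abs_robinLap_sub_le h₅ m (σ := σ) hj hj' hk hk' hF
    rw [opRobin_comb, hR j k hj hj' hk hk']
    have e : opRobin m.h K σ (fun i j k => U 0 0 0 (m.x i) (m.y j) (m.z k)) j k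
        + -1 * rhsRobin m K f fext g j k =
        robinLap m.h σ (fun i j k => U 0 0 0 (m.x i) (m.y j) (m.z k)) j k
      - 1 / 12 * (6 * jetLap U (m.x 0) (m.y j) (m.z k) + jetLap U (m.x 0) (m.y (j + 1)) (m.z k)
        + jetLap U (m.x 0) (m.y (j - 1)) (m.z k) + jetLap U (m.x 0) (m.y j) (m.z (k + 1))
        + jetLap U (m.x 0) (m.y j) (m.z (k - 1)) - (fext j k - K * (U 0 0 0 (m.x 1) (m.y j) (m.z k)
        - 2 * m.h * U 1 0 0 B.xl (m.y j) (m.z k))) + 3 * jetLap U (m.x 1) (m.y j) (m.z k))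
      + 2 / m.h * (-U 1 0 0 B.xl (m.y j) (m.z k) + σ * U 0 0 0 B.xl (m.y j) (m.z k)) := by
      have := m.Nx_pos
      simp only [opRobin, rhsRobin]
      rw [hf 0 j k (by unfold Mesh.IsGridIndex; lia),
        hf 0 (j + 1) k (by unfold Mesh.IsGridIndex; lia),
        hf 0 (j - 1) k (by unfold Mesh.IsGridIndex; lia),
        hf 0 j (k + 1) (by unfold Mesh.IsGridIndex; lia),
        hf 0 j (k - 1) (by unfold Mesh.IsGridIndex; lia),
        hf 1 j k (by unfold Mesh.IsGridIndex; lia), hgj, m.x_zero]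
      ring
    rw [e]
    refine h1.trans ?_
    -- Here the `h³` truncation error fits into `s / h` with `s` of order `h⁴`.
    rw [show (9 * M₆ + 11 * M₅ + c + |K| * M₃) * m.h ^ 4 / m.h
      = (9 * M₆ + 11 * M₅ + c + |K| * M₃) * m.h ^ 3 by field_simp]
    exact mul_le_mul_of_nonneg_right (by nlinarith) (by positivity)

end Error

end RobinHOC

/-! ### Partial derivatives of a `C^6` function on the closed box -/

namespace RobinHOC

variable {B : Box}

section WordDerivatives

variable {E : Type*} [NormedAddCommGroup E] [NormedSpace ℝ E]

/-- The iterated directional derivative of `u` within `S` along a list of directions, the last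
of which is applied first. -/
noncomputable def wordDeriv (S : Set E) (u : E → ℝ) : List E → E → ℝ
  | [] => u
  | v :: l => fun p => fderivWithin ℝ (wordDeriv S u l) S p v

variable {S : Set E} {u : E → ℝ}

theorem contDiffOn_wordDeriv (hS : UniqueDiffOn ℝ S) {n : ℕ} (hu : ContDiffOn ℝ n u S)
    (l : List E) : ∀ m : ℕ, l.length + m ≤ n → ContDiffOn ℝ m (wordDeriv S u l) S := by
  induction l with
  | nil => intro m hm; exact hu.of_le (by exact_mod_cast (by simpa using hm))
  | cons v l ih =>
    intro m hm
    refine ((ih (m + 1) (by simp at hm; lia)).fderivWithin hS (m := m) ?_).clm_apply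
      contDiffOn_const
    push_cast; rfl

/-- Adjacent swaps suffice, and each is the symmetry of the second derivative within `S`; at
boundary points this requires `S` to lie in the closure of its interior. -/
theorem wordDeriv_perm (hS : UniqueDiffOn ℝ S) (hS' : S ⊆ closure (interior S)) {n : ℕ}
    (hu : ContDiffOn ℝ n u S) {l l' : List E} (hp : l.Perm l') :
    l.length ≤ n → EqOn (wordDeriv S u l) (wordDeriv S u l') S := by
  induction hp with
  | nil => exact fun _ => eqOn_refl _ _
  | cons v _ ih =>
    intro hl p hp
    have h := ih (by simp at hl; lia)
    simp only [wordDeriv]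
    rw [fderivWithin_congr h (h hp)]
  | swap v w l =>
    intro hl p hp
    have hc := contDiffOn_wordDeriv hS hu l 2 (by simp at hl; lia)
    have hd : DifferentiableWithinAt ℝ (fderivWithin ℝ (wordDeriv S u l) S) S p :=
      (hc.fderivWithin hS (m := 1) (by norm_num)).differentiableOn (by norm_num) p hp
    have hsymm := (hc p hp).isSymmSndFDerivWithinAt (n := (2 : ℕ)) (by simp) hS (hS' hp) hp
    simp only [wordDeriv]
    rw [fderivWithin_clm_apply (hS p hp) hd (differentiableWithinAt_const _),
      fderivWithin_clm_apply (hS p hp) hd (differentiableWithinAt_const _)]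
    simpa using hsymm.eq w v
  | trans h₁ _ ih₁ ih₂ =>
    intro hl
    exact (ih₁ hl).trans (ih₂ (by rwa [← h₁.length_eq]))

/-- Evaluating at a direction of norm at most one does not increase norms and trades `m` derivatives
of a word for `m + 1` of its tail; hence the free `m` in the induction. -/
theorem norm_iteratedFDerivWithin_wordDeriv_le (hS : UniqueDiffOn ℝ S) {n : ℕ}
    (hu : ContDiffOn ℝ n u S) (l : List E) (hl : ∀ v ∈ l, ‖v‖ ≤ 1) :
    ∀ m N : ℕ, l.length + m = N → N ≤ n → ∀ p ∈ S,
      ‖iteratedFDerivWithin ℝ m (wordDeriv S u l) S p‖ ≤ ‖iteratedFDerivWithin ℝ N u S p‖ := by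
  induction l with
  | nil =>
    intro m N hN _ p _
    obtain rfl : m = N := by simpa using hN
    exact le_rfl
  | cons v l ih =>
    intro m N hN hm p hp
    simp only [List.length_cons] at hN
    have hc : ContDiffOn ℝ m (fderivWithin ℝ (wordDeriv S u l) S) S :=
      (contDiffOn_wordDeriv hS hu l (m + 1) (by lia)).fderivWithin hS (by push_cast; rfl)
    have h1 := norm_iteratedFDerivWithin_clm_apply_const (c := v) (hc p hp) hS hp (n := m) le_rfl
    rw [norm_iteratedFDerivWithin_fderivWithin hS hp] at h1
    refine h1.trans (le_trans ?_ (ih (fun w hw => hl w (by simp [hw])) (m + 1) N (by lia) hm p hp))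
    exact mul_le_of_le_one_left (norm_nonneg _) (hl v (by simp))

theorem abs_wordDeriv_le (hS : UniqueDiffOn ℝ S) {n : ℕ} (hu : ContDiffOn ℝ n u S) (l : List E)
    (hl : ∀ v ∈ l, ‖v‖ ≤ 1) (hn : l.length ≤ n) {p : E} (hp : p ∈ S) :
    |wordDeriv S u l p| ≤ ‖iteratedFDerivWithin ℝ l.length u S p‖ := by
  have := norm_iteratedFDerivWithin_wordDeriv_le hS hu l hl 0 _ rfl hn p hp
  rwa [norm_iteratedFDerivWithin_zero] at this

/-- Derivative along a line that stays in `S`. -/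
theorem hasDerivWithinAt_wordDeriv (hS : UniqueDiffOn ℝ S) {n : ℕ} (hu : ContDiffOn ℝ n u S)
    {l : List E} (hn : l.length < n) {γ : ℝ → E} {v : E} {I : Set ℝ} {t : ℝ}
    (hγ : HasDerivAt γ v t) (hI : MapsTo γ I S) (ht : t ∈ I) :
    HasDerivWithinAt (fun s => wordDeriv S u l (γ s)) (wordDeriv S u (v :: l) (γ t)) I t := by
  have hd := ((contDiffOn_wordDeriv hS hu l 1 (by lia)).differentiableOn (by norm_num) (γ t)
    (hI ht)).hasFDerivWithinAt
  exact hd.comp_hasDerivWithinAt t hγ.hasDerivWithinAt hI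

end WordDerivatives

section SmoothJet

theorem Box.interior_closed (B : Box) :
    interior B.closed = Ioo B.xl B.xr ×ˢ Ioo B.yl B.yr ×ˢ Ioo B.zl B.zr := by
  rw [Box.closed, interior_prod_eq, interior_prod_eq, interior_Icc, interior_Icc, interior_Icc]

theorem Box.closed_subset_closure_interior (B : Box) : B.closed ⊆ closure (interior B.closed) := by
  rw [B.interior_closed]; exact B.closed_subset_closure

theorem Box.uniqueDiffOn_closed (B : Box) : UniqueDiffOn ℝ B.closed :=
  (uniqueDiffOn_Icc B.hx).prod ((uniqueDiffOn_Icc B.hy).prod (uniqueDiffOn_Icc B.hz))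

/-- The list of directions of `∂_x^a ∂_y^b ∂_z^c`. -/
def axisWord (a b c : ℕ) : List (ℝ × ℝ × ℝ) :=
  List.replicate a (1, 0, 0) ++ (List.replicate b (0, 1, 0) ++ List.replicate c (0, 0, 1))

theorem length_axisWord (a b c : ℕ) : (axisWord a b c).length = a + b + c := by
  simp [axisWord]; ring

theorem axisWord_succ_left (a b c : ℕ) : axisWord (a + 1) b c = (1, 0, 0) :: axisWord a b c := by
  simp [axisWord, List.replicate_succ]

/-- A new `x`-direction already stands at the head of the word; only `y` and `z` must be moved into
place. -/
theorem axisWord_succ_mid (a b c : ℕ) :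
    ((0, 1, 0) :: axisWord a b c).Perm (axisWord a (b + 1) c) := by
  simp only [axisWord, List.replicate_succ (n := b), List.cons_append]
  exact List.perm_middle.symm

theorem axisWord_succ_right (a b c : ℕ) :
    ((0, 0, 1) :: axisWord a b c).Perm (axisWord a b (c + 1)) := by
  simp only [axisWord, List.replicate_succ (n := c), ← List.append_assoc]
  exact List.perm_middle.symm

theorem norm_le_of_mem_axisWord {a b c : ℕ} {v : ℝ × ℝ × ℝ} (hv : v ∈ axisWord a b c) :
    ‖v‖ ≤ 1 := by
  simp only [axisWord, List.mem_append, List.mem_replicate] at hv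
  rcases hv with ⟨_, rfl⟩ | ⟨_, rfl⟩ | ⟨_, rfl⟩ <;> simp [Prod.norm_def]

variable {u : ℝ × ℝ × ℝ → ℝ}

/-- The partial derivatives, within the box, of a function on the box. -/
noncomputable def smoothJet (B : Box) (u : ℝ × ℝ × ℝ → ℝ) (a b c : ℕ) (x y z : ℝ) : ℝ :=
  wordDeriv B.closed u (axisWord a b c) (x, y, z)

theorem jet_smoothJet (hu : ContDiffOn ℝ 6 u B.closed) : Jet B u (smoothJet B u) := by
  have hS := B.uniqueDiffOn_closed
  have hS' := B.closed_subset_closure_interior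
  have hu' : ContDiffOn ℝ (6 : ℕ) u B.closed := hu
  refine ⟨fun _ _ _ _ _ _ => rfl, fun a b c h => ?_, fun a b c h x hx y hy z hz => ?_,
    fun a b c h x hx y hy z hz => ?_, fun a b c h x hx y hy z hz => ?_⟩
  · exact (contDiffOn_wordDeriv hS hu' (axisWord a b c) 0
      (by rw [length_axisWord]; lia)).continuousOn
  · have := hasDerivWithinAt_wordDeriv hS hu' (l := axisWord a b c) (v := (1, 0, 0))
      (γ := fun s => (s, y, z)) (I := Icc B.xl B.xr) (t := x) (by rw [length_axisWord]; lia)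
      ((hasDerivAt_id x).prodMk (hasDerivAt_const x (y, z))) (fun s hs => ⟨hs, hy, hz⟩) hx
    rwa [← axisWord_succ_left] at this
  · have := hasDerivWithinAt_wordDeriv hS hu' (l := axisWord a b c) (v := (0, 1, 0))
      (γ := fun s => (x, s, z)) (I := Icc B.yl B.yr) (t := y) (by rw [length_axisWord]; lia)
      ((hasDerivAt_const y x).prodMk ((hasDerivAt_id y).prodMk (hasDerivAt_const y z)))
      (fun s hs => ⟨hx, hs, hz⟩) hy
    rwa [wordDeriv_perm hS hS' hu' (axisWord_succ_mid a b c)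
      (by simp only [List.length_cons, length_axisWord]; lia) ⟨hx, hy, hz⟩] at this
  · have := hasDerivWithinAt_wordDeriv hS hu' (l := axisWord a b c) (v := (0, 0, 1))
      (γ := fun s => (x, y, s)) (I := Icc B.zl B.zr) (t := z) (by rw [length_axisWord]; lia)
      ((hasDerivAt_const z x).prodMk ((hasDerivAt_const z y).prodMk (hasDerivAt_id z)))
      (fun s hs => ⟨hx, hy, hs⟩) hz
    rwa [wordDeriv_perm hS hS' hu' (axisWord_succ_right a b c)
      (by simp only [List.length_cons, length_axisWord]; lia) ⟨hx, hy, hz⟩] at this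

theorem jetBound_smoothJet (hu : ContDiffOn ℝ 6 u B.closed) {n : ℕ} (hn : n ≤ 6) {M : ℝ}
    (hM : ∀ p ∈ B.closed, ‖iteratedFDerivWithin ℝ n u B.closed p‖ ≤ M) :
    JetBound B (smoothJet B u) n M := by
  intro a b c h x hx y hy z hz
  have hu' : ContDiffOn ℝ (6 : ℕ) u B.closed := hu
  have hp : (x, y, z) ∈ B.closed := ⟨hx, hy, hz⟩
  have := abs_wordDeriv_le B.uniqueDiffOn_closed hu' (axisWord a b c)
    (fun v hv => norm_le_of_mem_axisWord hv) (by rw [length_axisWord]; lia) hp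
  rw [length_axisWord, h] at this
  exact this.trans (hM _ hp)

end SmoothJet

/-! ### Partial derivatives of a polynomial -/

section PolynomialJet

open MvPolynomial

theorem pderiv_comm' (i j : Fin 3) (p : MvPolynomial (Fin 3) ℝ) :
    pderiv i (pderiv j p) = pderiv j (pderiv i p) := by
  ext m
  simp only [coeff_pderiv, Finsupp.add_apply]
  rw [add_right_comm]
  by_cases h : i = j
  · subst h; rfl
  · simp [h, Ne.symm h]; ring

/-- Iterated partial derivatives of a polynomial. -/
noncomputable def polyDeriv (p : MvPolynomial (Fin 3) ℝ) (a b c : ℕ) : MvPolynomial (Fin 3) ℝ :=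
  (pderiv 0)^[a] ((pderiv 1)^[b] ((pderiv 2)^[c] p))

theorem polyDeriv_succ_left (p : MvPolynomial (Fin 3) ℝ) (a b c : ℕ) :
    polyDeriv p (a + 1) b c = pderiv 0 (polyDeriv p a b c) :=
  Function.iterate_succ_apply' _ _ _

theorem polyDeriv_succ_mid (p : MvPolynomial (Fin 3) ℝ) (a b c : ℕ) :
    polyDeriv p a (b + 1) c = pderiv 1 (polyDeriv p a b c) := by
  have h : Function.Commute (pderiv (R := ℝ) (1 : Fin 3)) (pderiv 0) := pderiv_comm' 1 0
  rw [polyDeriv, Function.iterate_succ_apply', polyDeriv]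
  exact ((h.iterate_right a) _).symm

theorem polyDeriv_succ_right (p : MvPolynomial (Fin 3) ℝ) (a b c : ℕ) :
    polyDeriv p a b (c + 1) = pderiv 2 (polyDeriv p a b c) := by
  have h : Function.Commute (pderiv (R := ℝ) (2 : Fin 3)) (pderiv 0) := pderiv_comm' 2 0
  have h' : Function.Commute (pderiv (R := ℝ) (2 : Fin 3)) (pderiv 1) := pderiv_comm' 2 1
  rw [polyDeriv, Function.iterate_succ_apply', polyDeriv]
  rw [← (h'.iterate_right b) _]
  exact ((h.iterate_right a) _).symm

theorem hasDerivAt_eval_pderiv (p : MvPolynomial (Fin 3) ℝ) {γ : ℝ → Fin 3 → ℝ} {i : Fin 3}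
    {t : ℝ} (hγ : ∀ j, HasDerivAt (fun s => γ s j) (Pi.single (M := fun _ => ℝ) i 1 j) t) :
    HasDerivAt (fun s => eval (γ s) p) (eval (γ t) (pderiv i p)) t := by
  induction p using MvPolynomial.induction_on with
  | C a => simpa using hasDerivAt_const t a
  | add p q hp hq => simp only [map_add]; exact hp.add hq
  | mul_X p j hp =>
    have := hp.mul (hγ j)
    simp only [map_mul, eval_X, pderiv_mul, map_add, pderiv_X]
    refine this.congr_deriv ?_
    by_cases h : i = j
    · subst h; simp
    · simp [Ne.symm h]

/-- The partial derivatives of a polynomial function. -/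
noncomputable def polyJet (p : MvPolynomial (Fin 3) ℝ) (a b c : ℕ) (x y z : ℝ) : ℝ :=
  eval ![x, y, z] (polyDeriv p a b c)

theorem jet_polyJet {u : ℝ × ℝ × ℝ → ℝ} {p : MvPolynomial (Fin 3) ℝ}
    (hp : ∀ x y z : ℝ, (x, y, z) ∈ B.closed → u (x, y, z) = eval ![x, y, z] p) :
    Jet B u (polyJet p) := by
  refine ⟨fun x hx y hy z hz => hp x y z ⟨hx, hy, hz⟩, fun a b c h => ?_,
    fun a b c h x hx y hy z hz => ?_, fun a b c h x hx y hy z hz => ?_,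
    fun a b c h x hx y hy z hz => ?_⟩
  · refine ((MvPolynomial.continuous_eval (polyDeriv p a b c)).comp
      (continuous_pi fun i => ?_)).continuousOn
    fin_cases i
    · exact continuous_fst
    · exact continuous_snd.fst
    · exact continuous_snd.snd
  · simp only [polyJet, polyDeriv_succ_left]
    refine (hasDerivAt_eval_pderiv _ (γ := fun s => ![s, y, z]) fun j => ?_).hasDerivWithinAt
    fin_cases j
    · simpa using hasDerivAt_id' x
    · simpa using hasDerivAt_const x y
    · simpa using hasDerivAt_const x z
  · simp only [polyJet, polyDeriv_succ_mid]
    refine (hasDerivAt_eval_pderiv _ (γ := fun s => ![x, s, z]) fun j => ?_).hasDerivWithinAt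
    fin_cases j
    · simpa using hasDerivAt_const y x
    · simpa using hasDerivAt_id' y
    · simpa using hasDerivAt_const y z
  · simp only [polyJet, polyDeriv_succ_right]
    refine (hasDerivAt_eval_pderiv _ (γ := fun s => ![x, y, s]) fun j => ?_).hasDerivWithinAt
    fin_cases j
    · simpa using hasDerivAt_const z x
    · simpa using hasDerivAt_const z y
    · simpa using hasDerivAt_id' z

/-- Each differentiation lowers by one the degree from which all coefficients vanish. -/
theorem coeff_iterate_pderiv {n : ℕ} (i : Fin 3) (k : ℕ) {p : MvPolynomial (Fin 3) ℝ}
    (hp : ∀ m : Fin 3 →₀ ℕ, n + k ≤ m.degree → coeff m p = 0) :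
    ∀ m : Fin 3 →₀ ℕ, n ≤ m.degree → coeff m ((pderiv i)^[k] p) = 0 := by
  induction k generalizing p with
  | zero => exact hp
  | succ k ih =>
    rw [Function.iterate_succ_apply]
    refine ih fun m hm => ?_
    rw [coeff_pderiv, hp _ (by simp; lia), zero_mul]

theorem polyDeriv_eq_zero {p : MvPolynomial (Fin 3) ℝ} {a b c : ℕ}
    (hp : p.totalDegree < a + b + c) : polyDeriv p a b c = 0 := by
  ext m
  rw [coeff_zero]
  refine coeff_iterate_pderiv (n := 0) 0 a (coeff_iterate_pderiv 1 b
    (coeff_iterate_pderiv 2 c fun m hm => ?_)) m (Nat.zero_le _)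
  refine coeff_eq_zero_of_totalDegree_lt ?_
  have : m.degree = ∑ i ∈ m.support, m i := rfl
  lia

theorem jetBound_polyJet_zero (B : Box) {p : MvPolynomial (Fin 3) ℝ} {n : ℕ}
    (hp : p.totalDegree < n) : JetBound B (polyJet p) n 0 := by
  intro a b c h x _ y _ z _
  rw [polyJet, polyDeriv_eq_zero (by lia)]
  simp

/-- Compactness of the box provides some bound. Its size is irrelevant: the order-three bound is
multiplied by `|K|`, and `K = 0` where this is applied. -/
theorem exists_jetBound_polyJet (B : Box) {u : ℝ × ℝ × ℝ → ℝ} {p : MvPolynomial (Fin 3) ℝ}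
    (J : Jet B u (polyJet p)) {n : ℕ} (hn : n ≤ 6) : ∃ M, JetBound B (polyJet p) n M := by
  have hc : IsCompact B.closed := isCompact_Icc.prod (isCompact_Icc.prod isCompact_Icc)
  have h : ∀ q : Fin (n + 1) × Fin (n + 1) × Fin (n + 1), ∃ M, q.1.1 + q.2.1.1 + q.2.2.1 = n →
      ∀ r ∈ B.closed, |polyJet p q.1 q.2.1 q.2.2 r.1 r.2.1 r.2.2| ≤ M := by
    intro q
    by_cases hq : q.1.1 + q.2.1.1 + q.2.2.1 = n
    · obtain ⟨M, hM⟩ := hc.exists_bound_of_continuousOn (J.cont q.1 q.2.1 q.2.2 (by lia))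
      exact ⟨M, fun _ => hM⟩
    · exact ⟨0, fun h => absurd h hq⟩
  choose M hM using h
  obtain ⟨C, hC⟩ := (Set.finite_range M).bddAbove
  refine ⟨C, fun a b c habc x hx y hy z hz => ?_⟩
  exact (hM (⟨a, by lia⟩, ⟨b, by lia⟩, ⟨c, by lia⟩) habc (x, y, z) ⟨hx, hy, hz⟩).trans
    (hC (mem_range_self _))

end PolynomialJet

end RobinHOC

/-! ### Assembly of the three claims -/

theorem mainTheorem6 (B : RobinHOC.Box) (K σ : ℝ) (hK : K ≤ 0) (hσ : 0 ≤ σ) :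
    -- the finite difference solution exists and is unique
    (∀ (m : RobinHOC.Mesh B) (f u₁ : ℝ × ℝ × ℝ → ℝ) (g : ℝ → ℝ → ℝ) (fext : ℤ → ℤ → ℝ),
      ∃ U : ℤ → ℤ → ℤ → ℝ, RobinHOC.IsFDSolution m K σ f fext u₁ g U ∧
        ∀ V : ℤ → ℤ → ℤ → ℝ, RobinHOC.IsFDSolution m K σ f fext u₁ g V →
          ∀ i j k : ℤ, m.IsGridIndex i j k → V i j k = U i j k) ∧
    -- exactness for quartic polynomials when `K = σ = 0`
    (K = 0 → σ = 0 →
      ∀ (u f u₁ : ℝ × ℝ × ℝ → ℝ) (g : ℝ → ℝ → ℝ),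
        RobinHOC.IsSolution B K σ u f u₁ g → RobinHOC.IsQuarticPolynomial B u →
        ∀ (m : RobinHOC.Mesh B) (fext : ℤ → ℤ → ℝ), RobinHOC.IsExtension m f 0 fext →
          ∀ U : ℤ → ℤ → ℤ → ℝ, RobinHOC.IsFDSolution m K σ f fext u₁ g U →
            ∀ i j k : ℤ, m.IsGridIndex i j k → U i j k = m.sample u i j k) ∧
    -- fourth order convergence in the maximum norm for solutions of class `C^6`
    (∃ C : ℝ, ∀ (u f u₁ : ℝ × ℝ × ℝ → ℝ) (g : ℝ → ℝ → ℝ),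
      RobinHOC.IsSolution B K σ u f u₁ g → ContDiffOn ℝ 6 u B.closed →
      ∀ M : ℝ, (∀ n : ℕ, n ≤ 6 → ∀ p ∈ B.closed,
          ‖iteratedFDerivWithin ℝ n u B.closed p‖ ≤ M) →
      ∀ c : ℝ, 0 ≤ c →
      ∀ (m : RobinHOC.Mesh B) (fext : ℤ → ℤ → ℝ), RobinHOC.IsExtension m f c fext →
        ∀ U : ℤ → ℤ → ℤ → ℝ, RobinHOC.IsFDSolution m K σ f fext u₁ g U →
          ∀ i j k : ℤ, m.IsGridIndex i j k →
            |m.sample u i j k - U i j k| ≤ C * (M + c) * m.h ^ 4) := by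
  refine ⟨fun m f u₁ g fext => RobinHOC.exists_unique_fdSolution m hK hσ f u₁ g fext, ?_, ?_⟩
  · rintro rfl - u f u₁ g S ⟨p, hp, hup⟩ m fext hext U hU i j k hg
    have J := RobinHOC.jet_polyJet hup
    obtain ⟨M, hM⟩ := RobinHOC.exists_jetBound_polyJet B J (n := 3) (by norm_num)
    have h := J.error_le hK hσ S hM (RobinHOC.jetBound_polyJet_zero B (by lia))
      (RobinHOC.jetBound_polyJet_zero B (by lia)) le_rfl m hext hU hg
    -- Derivatives of orders five and six vanish, as do `K` and the extension constant, so the whole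
    -- error constant is zero.
    simp only [mul_zero, abs_zero, zero_mul, add_zero] at h
    linarith [abs_nonpos_iff.1 h]
  -- `20 = 9 + 11` from the two truncation errors, `|K|` from the ghost value; the last factor is
  -- the stability constant.
  · refine ⟨(20 + |K|) * ((B.xr - B.xl) + (B.xr - B.xl) ^ 2 / 2), ?_⟩
    intro u f u₁ g S hu M hM c hc m fext hext U hU i j k hg
    have hb : ∀ n ≤ 6, RobinHOC.JetBound B (RobinHOC.smoothJet B u) n M := fun n hn =>
      RobinHOC.jetBound_smoothJet hu hn (hM n hn)
    refine ((RobinHOC.jet_smoothJet hu).error_le hK hσ S (hb 3 (by norm_num)) (hb 5 (by norm_num))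
      (hb 6 le_rfl) hc m hext hU hg).trans ?_
    have hL : 0 < B.xr - B.xl := sub_pos.2 B.hx
    have h1 : 9 * M + 11 * M + c + |K| * M ≤ (20 + |K|) * (M + c) := by
      nlinarith [mul_nonneg (abs_nonneg K) hc]
    have h2 := mul_le_mul_of_nonneg_right h1 (show 0 ≤ m.h ^ 4 *
      ((B.xr - B.xl) + (B.xr - B.xl) ^ 2 / 2) by have := m.h_pos; positivity)
    linarith
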